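/- **Setting.** Let $x\in\mathbb R^n$ be a fixed $k$-sparse vector (at most $k$ nonzero entries) with $\|x\|_2=1$. We observe $(A_i,y_i)_{i=1}^m$, where $y_i=x^\top A_i x$ and the $A_i\in\mathbb R^{n\times n}$ are independent with i.i.d. $\mathcal N(0,1)$ entries. Write $\widetilde A_i=\tfrac12(A_i+A_i^\top)$. Let $(\mathcal T_\tau)_{\tau\ge 0}$ be thresholding operators on $\mathbb R$, applied coordinatewise: $\mathcal T_\tau(a)=0$ if $|a|\le\tau$, and $|\mathcal T_\tau(a)-a|\le\tau$ if $|a|>\tau$ (e.g. hard or soft thresholding), with $(\tau,a)\mapsto\mathcal T_\tau(a)$ measurable. **Thresholded Wirtinger flow (TWF)** with parameters $\alpha,\beta,\mu$ and $T\ge 1$ iterations: *Spectral initialization.* Put $\phi=\big(\frac1m\sum_i y_i^2\big)^{1/4}$, $I_l=\frac1m\sum_i y_i (A_i)_{ll}$, $\widehat S_0=\{l\in\{1,\dots,n\}: I_l>\alpha\phi^2\sqrt{\log n/m}\}$ and $\widetilde S_{in}=\frac1m\sum_i y_i\widetilde A_i$. Let $\hat v_1$ be a unit eigenvector for the largest eigenvalue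 of the $n\times n$ matrix obtained from $\widetilde S_{in}$ by setting all entries outside $\widehat S_0\times\widehat S_0$ to zero, and put $\hat x_0=\phi\hat v_1$. *Updates.* For $t=0,\dots,T-1$ put $$\nabla f(\hat x_t)=\frac1m\sum_{i=1}^m(\hat x_t^\top A_i\hat x_t-y_i)\widetilde A_i\hat x_t,\qquad \tau(\hat x_t)=\Big[\frac{\beta}{m^2}\sum_{i=1}^m(\hat x_t^\top A_i\hat x_t-y_i)^2\Big]^{1/2}\|\hat x_t\|_2,$$ $$\hat x_{t+1}=\mathcal T_{\frac{\mu}{\phi^2}\tau(\hat x_t)}\Big(\hat x_t-\frac{\mu}{\phi^2}\nabla f(\hat x_t)\Big).$$ **Theorem 1 (Global linear convergence of TWF).** There are absolute constants $\alpha_0,b_0,\mu_0>0$ such that for all $\alpha_1,b_1$ there are constants $C_0,C_1,C_2,c>0$, depending only on $\alpha_1,b_1$, with the following property. Let $\alpha\in[\alpha_0,\alpha_1]$ (that is, $\alpha\asymp1$ suitably chosen), $\beta\in[b_0\log n,\,b_1\log n]$ (that is, $\beta\asymp\log n$ suitably chosen), $0<\mu\le\mu_0$ and $T\ge1$. If $m\ge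 C_0k^2\log n$, then with probability at least $1-C_1Tn^{-8}-C_2\exp(-cm)$, every sequence $\hat x_0,\dots,\hat x_T$ produced by TWF (whatever the choice of the leading eigenvector) satisfies $$\min\{\|\hat x_t-x\|_2,\ \|\hat x_t+x\|_2\}\le\Big(1-\frac{\mu}{16}\Big)^t\qquad\text{for all } t\in\{0,1,\dots,T\}.$$ -/

import Mathlib

open MeasureTheory ProbabilityTheory
open scoped Matrix

noncomputable section

namespace TWF

variable {n m : ℕ}

/-- A family of (coordinatewise) thresholding operators `𝒯 τ : ℝ → ℝ`, such as hard or soft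
thresholding. Level `τ = 0` (where the condition forces the identity) is included because the
data-driven level used by the algorithm may vanish. -/
def IsThresholding (𝒯 : ℝ → ℝ → ℝ) : Prop :=
  ∀ τ : ℝ, 0 ≤ τ → ∀ a : ℝ,
    (|a| ≤ τ → 𝒯 τ a = 0) ∧ (τ < |a| → |𝒯 τ a - a| ≤ τ)

/-- `x` has at most `k` nonzero entries. -/
def IsSparse (k : ℕ) (x : EuclideanSpace ℝ (Fin n)) : Prop :=
  (Finset.univ.filter fun j => x j ≠ 0).card ≤ k

/-- The quadratic form `zᵀ M z`. -/
def quad (M : Matrix (Fin n) (Fin n) ℝ) (z : EuclideanSpace ℝ (Fin n)) : ℝ :=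
  z.ofLp ⬝ᵥ (M *ᵥ z.ofLp)

/-- The symmetric part `(M + Mᵀ) / 2`. -/
def symPart (M : Matrix (Fin n) (Fin n) ℝ) : Matrix (Fin n) (Fin n) ℝ :=
  (1 / 2 : ℝ) • (M + Mᵀ)

/-- The norm estimate `φ = ((1/m) ∑ yᵢ²)^{1/4}`. -/
def phi (y : Fin m → ℝ) : ℝ :=
  ((1 / (m : ℝ)) * ∑ i, y i ^ 2) ^ (1 / 4 : ℝ)

/-- The statistic `I_l = (1/m) ∑ yᵢ (Aᵢ)_{ll}`. -/
def diagStat (A : Fin m → Matrix (Fin n) (Fin n) ℝ) (y : Fin m → ℝ) (l : Fin n) : ℝ :=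
  (1 / (m : ℝ)) * ∑ i, y i * A i l l

/-- The estimated support `{l : I_l > α φ² √(log n / m)}`. -/
def suppEst (α : ℝ) (A : Fin m → Matrix (Fin n) (Fin n) ℝ) (y : Fin m → ℝ) : Finset (Fin n) :=
  Finset.univ.filter fun l =>
    α * phi y ^ 2 * Real.sqrt (Real.log n / m) < diagStat A y l

/-- The matrix `(1/m) ∑ yᵢ Aᵢ`. -/
def dataMatrix (A : Fin m → Matrix (Fin n) (Fin n) ℝ) (y : Fin m → ℝ) :
    Matrix (Fin n) (Fin n) ℝ :=
  (1 / (m : ℝ)) • ∑ i, y i • A i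

/-- `[M]_{S,S}`: entries outside `S × S` are set to zero. -/
def restrict (S : Finset (Fin n)) (M : Matrix (Fin n) (Fin n) ℝ) : Matrix (Fin n) (Fin n) ℝ :=
  Matrix.of fun j l => if j ∈ S ∧ l ∈ S then M j l else 0

/-- `v` is a unit eigenvector of `M` belonging to the largest real eigenvalue of `M`. -/
def IsLeadingEigenvector (M : Matrix (Fin n) (Fin n) ℝ) (v : EuclideanSpace ℝ (Fin n)) : Prop :=
  ‖v‖ = 1 ∧ ∃ ev : ℝ, M *ᵥ v.ofLp = ev • v.ofLp ∧
    ∀ (ν : ℝ) (w : Fin n → ℝ), w ≠ 0 → M *ᵥ w = ν • w → ν ≤ ev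

/-- `z` is an output of the spectral initialization: `φ` times a unit leading eigenvector of the
symmetrized data matrix restricted to the estimated support. -/
def IsSpectralInit (α : ℝ) (A : Fin m → Matrix (Fin n) (Fin n) ℝ) (y : Fin m → ℝ)
    (z : EuclideanSpace ℝ (Fin n)) : Prop :=
  ∃ v : EuclideanSpace ℝ (Fin n),
    IsLeadingEigenvector (restrict (suppEst α A y) (symPart (dataMatrix A y))) v ∧
      z = phi y • v

/-- The gradient `(1/m) ∑ (zᵀ Aᵢ z - yᵢ) Ãᵢ z` of the loss `(1/(4m)) ∑ (zᵀ Aᵢ z - yᵢ)²`,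
where `Ãᵢ` is the symmetric part of `Aᵢ`. -/
def grad (A : Fin m → Matrix (Fin n) (Fin n) ℝ) (y : Fin m → ℝ) (z : EuclideanSpace ℝ (Fin n)) :
    EuclideanSpace ℝ (Fin n) :=
  (1 / (m : ℝ)) • ∑ i, (quad (A i) z - y i) • WithLp.toLp 2 (symPart (A i) *ᵥ z.ofLp)

/-- The threshold level `[(β/m²) ∑ (zᵀ Aᵢ z - yᵢ)²]^{1/2} ‖z‖₂`. -/
def level (β : ℝ) (A : Fin m → Matrix (Fin n) (Fin n) ℝ) (y : Fin m → ℝ)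
    (z : EuclideanSpace ℝ (Fin n)) : ℝ :=
  Real.sqrt (β / (m : ℝ) ^ 2 * ∑ i, (quad (A i) z - y i) ^ 2) * ‖z‖

/-- One thresholded gradient descent update. -/
def update (𝒯 : ℝ → ℝ → ℝ) (β μ : ℝ) (A : Fin m → Matrix (Fin n) (Fin n) ℝ) (y : Fin m → ℝ)
    (z : EuclideanSpace ℝ (Fin n)) : EuclideanSpace ℝ (Fin n) :=
  WithLp.toLp 2 fun j =>
    𝒯 (μ / phi y ^ 2 * level β A y z) (z j - μ / phi y ^ 2 * grad A y z j)

/-- `z 0, …, z T` is a sequence produced by `T` iterations of thresholded Wirtinger flow on the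
data `(Aᵢ, yᵢ)` (for some choice of the leading eigenvector in the initialization). -/
def IsTWFSequence (𝒯 : ℝ → ℝ → ℝ) (α β μ : ℝ) (T : ℕ)
    (A : Fin m → Matrix (Fin n) (Fin n) ℝ) (y : Fin m → ℝ)
    (z : ℕ → EuclideanSpace ℝ (Fin n)) : Prop :=
  IsSpectralInit α A y (z 0) ∧ ∀ t < T, z (t + 1) = update 𝒯 β μ A y (z t)

/-- The random matrices `A₁, …, A_m` are i.i.d. with i.i.d. standard Gaussian entries. -/
def IsStdGaussianFamily {Ω : Type*} [MeasurableSpace Ω] (P : Measure Ω)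
    (A : Fin m → Ω → Matrix (Fin n) (Fin n) ℝ) : Prop :=
  (∀ i j l, HasLaw (fun ω => A i ω j l) (gaussianReal 0 1) P) ∧
    iIndepFun (fun (p : Fin m × Fin n × Fin n) ω => A p.1 ω p.2.1 p.2.2) P

end TWF

end

/-! Flattening each matrix turns the data into Gaussian vectors on `Fin n × Fin n`. Observations,
gradient, threshold level and spectral matrix are then all read off one bilinear form, `gram`, whose
expectation is the Euclidean inner product. Let `S` be the support of `x`. A net argument
(`isRIP_probability`) makes `gram` uniformly close to the inner product on vectors supported on `S ×
S`; there are at most `k²` such coordinates, which costs `m ≳ k² log n`.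

As long as everything stays supported on `S`, the analysis is deterministic. The restricted spectral
matrix is nearly `x xᵀ`, so its leading eigenvector is nearly `±x` (`nearRankOne_restrict`,
`leading_eigenvector_overlap`). Near `±x` the population gradient step contracts, and both the
gradient error and the thresholding bias are small multiples of the current distance
(`norm_update_sub_le`).

It remains to see that no coordinate outside `S` is ever switched on. For `j ∉ S` the `j`-th
gradient coordinate only involves matrix entries outside `S × S`. If the iterate depends only on the
entries inside, that coordinate is conditionally Gaussian with standard deviation at most `level /
√β`, and `β ≳ log n` makes the threshold kill it (`grad_notMem_tail`). The true iterates depend on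
all entries, so they are compared with the run on data masked to `S × S`. The masked run stays in
`S` for every data array, and on the good event the true run coincides with it, step by step
(`update_mask`, `GoodData.dist_le`).

The leading eigenvector is an arbitrary choice and need not be measurable in the data. Power
iteration started at the fixed vector `x` provides a measurable representative, unique up to sign
(`tendsto_powerIter`); the good event covers both signs. -/

noncomputable section

namespace TWF

/-! ### Gaussian tails, conditional Gaussian tails and the chi-square moment generating function -/

section Gaussian

/-- The law of a finite family of independent standard Gaussian variables. -/
abbrev gaussianPi (ι : Type*) [Fintype ι] : Measure (ι → ℝ) :=
  Measure.pi fun _ => gaussianReal 0 1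

variable {ι κ : Type*} [Fintype ι] [Fintype κ]

lemma hasLaw_sum_mul_gaussianPi (u : ι → ℝ) (hu : ∑ p, u p ^ 2 = 1) :
    HasLaw (fun b : ι → ℝ => ∑ p, u p * b p) (gaussianReal 0 1) (gaussianPi ι) := by
  refine ⟨Measurable.aemeasurable (by fun_prop), ?_⟩
  let L : StrongDual ℝ (EuclideanSpace ℝ ι) := innerSL ℝ (WithLp.toLp 2 u)
  have hL : ‖L‖ ^ 2 = 1 := by
    rw [innerSL_apply_norm, EuclideanSpace.norm_sq_eq]
    simpa using hu
  have h := IsGaussian.map_eq_gaussianReal (μ := stdGaussian (EuclideanSpace ℝ ι)) L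
  rw [integral_strongDual_stdGaussian, variance_dual_stdGaussian, hL,
    ← map_pi_eq_stdGaussian, Measure.map_map (by fun_prop) (by fun_prop)] at h
  rw [Real.toNNReal_one] at h
  rw [← h]
  congr 1
  ext b
  simp [L, PiLp.inner_apply, mul_comm]

lemma hasSubgaussianMGF_sum_mul_gaussianPi (u : ι → ℝ) :
    HasSubgaussianMGF (fun b : ι → ℝ => ∑ p, u p * b p) (∑ p, Real.toNNReal (u p ^ 2))
      (gaussianPi ι) := by
  have hind : iIndepFun (fun p (b : ι → ℝ) => u p * b p) (gaussianPi ι) :=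
    iIndepFun_pi (X := fun p x => u p * x) (fun p => by fun_prop)
  refine HasSubgaussianMGF.sum_of_iIndepFun hind fun p _ => ?_
  have h1 : HasSubgaussianMGF (fun b : ι → ℝ => b p) 1 (gaussianPi ι) := by
    have hid : HasSubgaussianMGF (id : ℝ → ℝ) 1 (gaussianReal 0 1) := by
      refine ⟨fun t => integrable_exp_mul_gaussianReal t, fun t => ?_⟩
      rw [mgf_id_gaussianReal]
      simp
    have hmp := measurePreserving_eval (fun _ : ι => gaussianReal 0 1) p
    exact HasSubgaussianMGF.of_map (μ := gaussianPi ι) (X := (id : ℝ → ℝ))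
      (Y := fun b : ι → ℝ => b p) (measurable_pi_apply p).aemeasurable (by rwa [hmp.map_eq])
  have h2 := h1.const_mul (u p)
  convert h2 using 1
  ext
  rw [Real.coe_toNNReal _ (sq_nonneg (u p))]
  exact (mul_one (u p ^ 2)).symm

lemma gaussianPi_linear_tail (u : ι → ℝ) {s : ℝ} (hs : 0 ≤ s) :
    (gaussianPi ι).real {b | s * √(∑ p, u p ^ 2) < |∑ p, u p * b p|} ≤
      2 * Real.exp (-s ^ 2 / 2) := by
  set σ := √(∑ p, u p ^ 2) with hσ
  have hσ0 : 0 ≤ σ := Real.sqrt_nonneg _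
  have hσ2 : σ ^ 2 = ∑ p, u p ^ 2 := Real.sq_sqrt (Finset.sum_nonneg fun p _ => sq_nonneg _)
  rcases hσ0.eq_or_lt with h0 | hpos
  -- With zero coefficients the event is empty because its inequality is strict; the conditional
  -- version needs this case, since its random coefficients may vanish.
  · have hu : ∀ p, u p = 0 := by
      intro p
      rw [← h0] at hσ2
      have := (Finset.sum_eq_zero_iff_of_nonneg (fun p _ => sq_nonneg (u p))).1
        (by rw [← hσ2]; norm_num : ∑ p, u p ^ 2 = 0) p (Finset.mem_univ p)
      exact pow_eq_zero_iff (two_ne_zero) |>.1 this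
    have : {b : ι → ℝ | s * σ < |∑ p, u p * b p|} = ∅ := by
      ext b
      simp [hu, ← h0]
    rw [this, measureReal_empty]
    positivity
  · have hc : ((∑ p, Real.toNNReal (u p ^ 2) : NNReal) : ℝ) = σ ^ 2 := by
      rw [hσ2]
      push_cast
      exact Finset.sum_congr rfl fun p _ => Real.coe_toNNReal _ (sq_nonneg _)
    have hX := hasSubgaussianMGF_sum_mul_gaussianPi u
    have hε : 0 ≤ s * σ := by positivity
    have e : -(s * σ) ^ 2 / (2 * σ ^ 2) = -s ^ 2 / 2 := by
      field_simp
    have h1 := hX.measure_ge_le hε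
    have h2 := hX.neg.measure_ge_le hε
    rw [hc, e] at h1 h2
    calc (gaussianPi ι).real {b | s * σ < |∑ p, u p * b p|}
        ≤ (gaussianPi ι).real ({b | s * σ ≤ ∑ p, u p * b p} ∪
            {b | s * σ ≤ (-fun b : ι → ℝ => ∑ p, u p * b p) b}) := by
          refine measureReal_mono ?_ 
          intro b hb
          simp only [Set.mem_ofPred_eq, Set.mem_union, Pi.neg_apply] at hb ⊢
          rcases lt_abs.1 hb with h | h
          · exact Or.inl h.le
          · exact Or.inr h.le
      _ ≤ _ := measureReal_union_le _ _
      _ ≤ _ := by linarith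

/-- Resampling the coordinates outside `B` preserves the Gaussian law. -/
lemma measurePreserving_splice (B : Set ι) [DecidablePred (· ∈ B)] :
    MeasurePreserving (fun (q : (ι → ℝ) × (ι → ℝ)) p => if p ∈ B then q.1 p else q.2 p)
      ((gaussianPi ι).prod (gaussianPi ι)) (gaussianPi ι) := by
  have hm : Measurable
      (fun (q : (ι → ℝ) × (ι → ℝ)) (p : ι) => if p ∈ B then q.1 p else q.2 p) := by
    refine measurable_pi_lambda _ fun p => ?_
    by_cases h : p ∈ B <;> simp only [h, if_true, if_false] <;> fun_prop
  refine ⟨hm, ?_⟩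
  symm
  refine Measure.pi_eq fun s hs => ?_
  rw [Measure.map_apply hm (MeasurableSet.univ_pi hs)]
  have : (fun (q : (ι → ℝ) × (ι → ℝ)) (p : ι) => if p ∈ B then q.1 p else q.2 p) ⁻¹'
      (Set.univ.pi s) = (Set.univ.pi fun p => if p ∈ B then s p else Set.univ) ×ˢ
        (Set.univ.pi fun p => if p ∈ B then Set.univ else s p) := by
    ext q
    simp only [Set.mem_preimage, Set.mem_pi, Set.mem_univ, true_imp_iff, Set.mem_prod,
      ← forall_and]
    refine forall_congr' fun p => ?_
    by_cases h : p ∈ B <;> simp [h]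
  rw [this, Measure.prod_prod, Measure.pi_pi, Measure.pi_pi, ← Finset.prod_mul_distrib]
  refine Finset.prod_congr rfl fun p _ => ?_
  by_cases h : p ∈ B <;> simp [h]

/-- Conditional Gaussian tail bound: the coefficients may depend on coordinates in `B`, as long as
they vanish there. -/
lemma gaussianPi_conditional_tail (B : Set ι) [DecidablePred (· ∈ B)]
    (c : (ι → ℝ) → ι → ℝ) (hc : Measurable c)
    (hdep : ∀ a b, (∀ p ∈ B, a p = b p) → c a = c b) (hzero : ∀ a, ∀ p ∈ B, c a p = 0)
    {s : ℝ} (hs : 0 ≤ s) :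
    (gaussianPi ι).real {a | s * √(∑ p, c a p ^ 2) < |∑ p, c a p * a p|} ≤
      2 * Real.exp (-s ^ 2 / 2) := by
  have hcp : ∀ p, Measurable fun a => c a p := fun p => (measurable_pi_apply p).comp hc
  set E : Set (ι → ℝ) := {a | s * √(∑ p, c a p ^ 2) < |∑ p, c a p * a p|} with hE
  have hEm : MeasurableSet E := by
    refine measurableSet_lt ?_ ?_ <;> fun_prop
  have hmp := measurePreserving_splice (ι := ι) B
  -- Resample the coordinates outside `B` from an independent copy. The coefficients do not see the
  -- change and the terms in `B` vanish, so coefficients and Gaussian variables become independent,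
  -- and Fubini reduces to fixed coefficients.
  have hF : (gaussianPi ι) E = ((gaussianPi ι).prod (gaussianPi ι))
      {q | s * √(∑ p, c q.1 p ^ 2) < |∑ p, c q.1 p * q.2 p|} := by
    rw [← hmp.measure_preimage hEm.nullMeasurableSet]
    congr 1
    ext q
    have h1 : c (fun p => if p ∈ B then q.1 p else q.2 p) = c q.1 :=
      hdep _ _ fun p hp => by simp [hp]
    have h2 : ∀ p, c q.1 p * (if p ∈ B then q.1 p else q.2 p) = c q.1 p * q.2 p := by
      intro p
      by_cases hp : p ∈ B
      · simp [hzero _ p hp]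
      · simp [hp]
    simp only [hE, Set.mem_preimage, Set.mem_ofPred_eq, h1, h2]
  have hm : MeasurableSet {q : (ι → ℝ) × (ι → ℝ) |
      s * √(∑ p, c q.1 p ^ 2) < |∑ p, c q.1 p * q.2 p|} := by
    have : ∀ p, Measurable fun q : (ι → ℝ) × (ι → ℝ) => c q.1 p :=
      fun p => (hcp p).comp measurable_fst
    refine measurableSet_lt ?_ ?_ <;> fun_prop
  rw [measureReal_def, hF, Measure.prod_apply hm]
  refine ENNReal.toReal_le_of_le_ofReal (by positivity) ?_
  calc _ ≤ ∫⁻ _ : ι → ℝ, ENNReal.ofReal (2 * Real.exp (-s ^ 2 / 2)) ∂(gaussianPi ι) := by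
        refine lintegral_mono fun a => ?_
        have := gaussianPi_linear_tail (c a) hs
        rw [measureReal_def] at this
        exact (ENNReal.le_ofReal_iff_toReal_le (measure_ne_top _ _) (by positivity)).2 this
    _ = _ := by simp

lemma measurePreserving_uncurry :
    MeasurePreserving (fun (b : ι → κ → ℝ) (p : ι × κ) => b p.1 p.2)
      (Measure.pi fun _ => gaussianPi κ) (gaussianPi (ι × κ)) := by
  have hm : Measurable (fun (b : ι → κ → ℝ) (p : ι × κ) => b p.1 p.2) := by fun_prop
  refine ⟨hm, ?_⟩
  symm
  refine Measure.pi_eq fun s hs => ?_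
  rw [Measure.map_apply hm (MeasurableSet.univ_pi hs)]
  have : (fun (b : ι → κ → ℝ) (p : ι × κ) => b p.1 p.2) ⁻¹' (Set.univ.pi s) =
      Set.univ.pi fun i => Set.univ.pi fun j => s (i, j) := by
    ext b
    simp [Set.mem_pi]
  rw [this, Measure.pi_pi, Fintype.prod_prod_type]
  exact Finset.prod_congr rfl fun i _ => Measure.pi_pi _ _

/-- The integral equals `e^{-t} (1 - 2t)^{-1/2}`. The bound follows from `log y ≥ 1 - 1/y` at `y = 1
- 2t`, together with `1/y ≤ 1 + 2t + 8t²`, which is where `t ≤ 1/4` enters. -/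
lemma integral_exp_sq_gaussianReal {t : ℝ} (ht : |t| ≤ 1 / 4) :
    Integrable (fun x : ℝ => Real.exp (t * (x ^ 2 - 1))) (gaussianReal 0 1) ∧
    ∫ x, Real.exp (t * (x ^ 2 - 1)) ∂(gaussianReal 0 1) ≤ Real.exp (4 * t ^ 2) := by
  obtain ⟨ht1, ht2⟩ := abs_le.1 ht
  have hb : 0 < 1 / 2 - t := by linarith
  have hpt : ∀ x : ℝ, gaussianPDFReal 0 1 x • Real.exp (t * (x ^ 2 - 1)) =
      ((√(2 * Real.pi))⁻¹ * Real.exp (-t)) * Real.exp (-(1 / 2 - t) * x ^ 2) := by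
    intro x
    simp only [gaussianPDFReal, NNReal.coe_one, mul_one, sub_zero, smul_eq_mul]
    rw [mul_assoc, mul_assoc, ← Real.exp_add, ← Real.exp_add]
    congr 2
    ring
  have hval : ∫ x, Real.exp (t * (x ^ 2 - 1)) ∂(gaussianReal 0 1) =
      Real.exp (-t) * (√(1 - 2 * t))⁻¹ := by
    rw [integral_gaussianReal_eq_integral_smul one_ne_zero]
    simp_rw [hpt]
    rw [integral_const_mul, integral_gaussian]
    have : Real.pi / (1 / 2 - t) = 2 * Real.pi / (1 - 2 * t) := by
      have : 1 - 2 * t ≠ 0 := by linarith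
      field_simp
    rw [this, Real.sqrt_div (by positivity)]
    have : √(2 * Real.pi) ≠ 0 := by positivity
    field_simp
  constructor
  · rw [gaussianReal_of_var_ne_zero _ one_ne_zero]
    have hlt : ∀ᵐ x : ℝ, gaussianPDF 0 1 x < ⊤ :=
      Filter.Eventually.of_forall fun x => gaussianPDF_lt_top
    rw [integrable_withDensity_iff_integrable_smul' (measurable_gaussianPDF 0 1) hlt]
    simp_rw [toReal_gaussianPDF, hpt]
    exact (integrable_exp_neg_mul_sq hb).const_mul _
  · rw [hval]
    have h1 : 0 < 1 - 2 * t := by linarith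
    have h2 : -(2 * t + 8 * t ^ 2) ≤ Real.log (1 - 2 * t) := by
      have := Real.one_sub_inv_le_log_of_pos h1
      refine le_trans ?_ this
      have : (1 - 2 * t)⁻¹ ≤ 1 + 2 * t + 8 * t ^ 2 := by
        rw [inv_le_iff_one_le_mul₀ h1]
        nlinarith [sq_nonneg t, mul_nonneg (sq_nonneg t) (by linarith : 0 ≤ 1 - 4 * t)]
      linarith
    have h3 : (√(1 - 2 * t))⁻¹ = Real.exp (-(Real.log (1 - 2 * t) / 2)) := by
      rw [Real.exp_neg, ← Real.log_sqrt h1.le, Real.exp_log (Real.sqrt_pos.2 h1)]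
    rw [h3, ← Real.exp_add]
    exact Real.exp_le_exp.2 (by linarith)

end Gaussian

/-! ### Concentration of the empirical second moment form -/

section Concentration

variable {κ : Type*} [Fintype κ] {m : ℕ}

/-- Chernoff's bound on both sides with `t = ±ε/8`: the exponent is `-mε²/8 + 4m(ε/8)² = -mε²/16`,
and `ε ≤ 2` keeps `|t| ≤ 1/4`. -/
lemma chiSq_tail (u : κ → ℝ) (hu : ∑ p, u p ^ 2 = 1) {ε : ℝ} (hε : 0 ≤ ε) (hε2 : ε ≤ 2) :
    (gaussianPi (Fin m × κ)).real
      {a | ε * m < |∑ i, ((∑ p, u p * a (i, p)) ^ 2 - 1)|} ≤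
      2 * Real.exp (-(m * ε ^ 2 / 16)) := by
  set Q : Measure (Fin m → κ → ℝ) := Measure.pi fun _ => gaussianPi κ with hQ
  let X : Fin m → (Fin m → κ → ℝ) → ℝ := fun i b => (∑ p, u p * b i p) ^ 2 - 1
  have hXm : ∀ i, Measurable (X i) := fun i => by fun_prop
  have hind : iIndepFun X Q :=
    iIndepFun_pi (X := fun _ (b : κ → ℝ) => (∑ p, u p * b p) ^ 2 - 1)
      (fun i => Measurable.aemeasurable (by fun_prop))
  have hlaw : ∀ i, HasLaw (fun b : Fin m → κ → ℝ => ∑ p, u p * b i p) (gaussianReal 0 1) Q :=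
    fun i => (hasLaw_sum_mul_gaussianPi u hu).comp
      (measurePreserving_eval (fun _ : Fin m => gaussianPi κ) i).hasLaw
  have hint : ∀ i {t : ℝ}, |t| ≤ 1 / 4 → Integrable (fun b => Real.exp (t * X i b)) Q := by
    intro i t ht
    have h := (integral_exp_sq_gaussianReal ht).1
    rw [← (hlaw i).map_eq] at h
    exact (integrable_map_measure (Measurable.aestronglyMeasurable (by fun_prop))
      (hlaw i).aemeasurable).1 h
  have hmgf : ∀ i {t : ℝ}, |t| ≤ 1 / 4 → mgf (X i) Q t ≤ Real.exp (4 * t ^ 2) := by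
    intro i t ht
    have h := (integral_exp_sq_gaussianReal ht).2
    rw [← (hlaw i).integral_comp (Measurable.aestronglyMeasurable (by fun_prop))] at h
    exact h
  have hsum : ∀ {t : ℝ}, |t| ≤ 1 / 4 → mgf (∑ i, X i) Q t ≤ Real.exp (m * (4 * t ^ 2)) := by
    intro t ht
    rw [hind.mgf_sum hXm]
    calc ∏ i, mgf (X i) Q t ≤ ∏ _i : Fin m, Real.exp (4 * t ^ 2) :=
          Finset.prod_le_prod (fun i _ => mgf_nonneg) fun i _ => hmgf i ht
      _ = _ := by rw [Finset.prod_const, Finset.card_univ, Fintype.card_fin, ← Real.exp_nat_mul]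
  have hsint : ∀ {t : ℝ}, |t| ≤ 1 / 4 →
      Integrable (fun b => Real.exp (t * (∑ i, X i) b)) Q := fun ht =>
    hind.integrable_exp_mul_sum hXm fun i _ => hint i ht
  have hm0 : (0 : ℝ) ≤ m := Nat.cast_nonneg m
  have ht : |ε / 8| ≤ 1 / 4 := by rw [abs_of_nonneg (by positivity)]; linarith
  have ht' : |-(ε / 8)| ≤ 1 / 4 := by rwa [abs_neg]
  have h1 := measure_ge_le_exp_mul_mgf (μ := Q) (ε * m) (by positivity : 0 ≤ ε / 8) (hsint ht)
  have h2 := measure_le_le_exp_mul_mgf (μ := Q) (-(ε * m))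
    (by linarith : -(ε / 8) ≤ 0) (hsint ht')
  have e1 : Real.exp (-(ε / 8) * (ε * m)) * mgf (∑ i, X i) Q (ε / 8) ≤
      Real.exp (-(m * ε ^ 2 / 16)) := by
    refine (mul_le_mul_of_nonneg_left (hsum ht) (Real.exp_nonneg _)).trans ?_
    rw [← Real.exp_add]
    exact Real.exp_le_exp.2 (by nlinarith)
  have e2 : Real.exp (-(-(ε / 8)) * (-(ε * m))) * mgf (∑ i, X i) Q (-(ε / 8)) ≤
      Real.exp (-(m * ε ^ 2 / 16)) := by
    refine (mul_le_mul_of_nonneg_left (hsum ht') (Real.exp_nonneg _)).trans ?_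
    rw [← Real.exp_add]
    exact Real.exp_le_exp.2 (by nlinarith)
  have hmp := measurePreserving_uncurry (ι := Fin m) (κ := κ)
  have hEm : MeasurableSet {a : Fin m × κ → ℝ |
      ε * m < |∑ i, ((∑ p, u p * a (i, p)) ^ 2 - 1)|} := by
    refine measurableSet_lt ?_ ?_ <;> fun_prop
  rw [← hmp.measureReal_preimage hEm.nullMeasurableSet]
  calc _ ≤ Q.real ({b | ε * m ≤ (∑ i, X i) b} ∪ {b | (∑ i, X i) b ≤ -(ε * m)}) := by
        refine measureReal_mono ?_
        intro b hb
        simp only [Set.mem_preimage, Set.mem_ofPred_eq] at hb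
        simp only [Set.mem_union, Set.mem_ofPred_eq, Finset.sum_apply, X]
        rcases lt_abs.1 hb with h | h
        · exact Or.inl h.le
        · exact Or.inr (by linarith)
    _ ≤ _ := measureReal_union_le _ _
    _ ≤ _ := by linarith

/-- The `i`-th measurement vector of the data array `a`. -/
def row (a : Fin m × κ → ℝ) (i : Fin m) : EuclideanSpace ℝ κ :=
  WithLp.toLp 2 fun p => a (i, p)

/-- The empirical second moment form `(1/m) ∑ ⟪aᵢ, M⟫ ⟪aᵢ, N⟫`. -/
def gram (a : Fin m × κ → ℝ) (M N : EuclideanSpace ℝ κ) : ℝ :=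
  (1 / (m : ℝ)) * ∑ i, inner ℝ (row a i) M * inner ℝ (row a i) N

lemma inner_row (a : Fin m × κ → ℝ) (i : Fin m) (M : EuclideanSpace ℝ κ) :
    inner ℝ (row a i) M = ∑ p, M p * a (i, p) := by
  simp [row, PiLp.inner_apply]

lemma gram_comm (a : Fin m × κ → ℝ) (M N : EuclideanSpace ℝ κ) : gram a M N = gram a N M := by
  simp only [gram, mul_comm]

lemma gram_add_left (a : Fin m × κ → ℝ) (M M' N : EuclideanSpace ℝ κ) :
    gram a (M + M') N = gram a M N + gram a M' N := by
  simp only [gram, inner_add_right, add_mul, Finset.sum_add_distrib, mul_add]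

lemma gram_smul_left (a : Fin m × κ → ℝ) (r : ℝ) (M N : EuclideanSpace ℝ κ) :
    gram a (r • M) N = r * gram a M N := by
  simp only [gram, inner_smul_right, Finset.mul_sum]
  exact Finset.sum_congr rfl fun i _ => by ring

lemma gram_add_right (a : Fin m × κ → ℝ) (M N N' : EuclideanSpace ℝ κ) :
    gram a M (N + N') = gram a M N + gram a M N' := by
  rw [gram_comm, gram_add_left, gram_comm a N, gram_comm a N']

lemma gram_smul_right (a : Fin m × κ → ℝ) (r : ℝ) (M N : EuclideanSpace ℝ κ) :
    gram a M (r • N) = r * gram a M N := by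
  rw [gram_comm, gram_smul_left, gram_comm]

lemma gram_self_tail (hm : 0 < m) (M : EuclideanSpace ℝ κ) {ε : ℝ} (hε : 0 ≤ ε) (hε2 : ε ≤ 2) :
    (gaussianPi (Fin m × κ)).real {a | ε * ‖M‖ ^ 2 < |gram a M M - ‖M‖ ^ 2|} ≤
      2 * Real.exp (-(m * ε ^ 2 / 16)) := by
  have hm0 : (0 : ℝ) < m := Nat.cast_pos.2 hm
  by_cases hM : M = 0
  · subst hM
    simp only [gram, norm_zero, inner_zero_right]
    simp
    positivity
  · have hM0 : 0 < ‖M‖ := norm_pos_iff.2 hM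
    have hu : ∑ p, (M p / ‖M‖) ^ 2 = 1 := by
      simp only [div_pow, ← Finset.sum_div]
      rw [div_eq_one_iff_eq (by positivity), EuclideanSpace.norm_sq_eq]
      simp
    refine le_trans (measureReal_mono ?_) (chiSq_tail (m := m) _ hu hε hε2)
    intro a ha
    simp only [Set.mem_ofPred_eq] at ha ⊢
    have e : ∑ i, ((∑ p, M p / ‖M‖ * a (i, p)) ^ 2 - 1) =
        m / ‖M‖ ^ 2 * (gram a M M - ‖M‖ ^ 2) := by
      simp only [gram, inner_row, div_mul_eq_mul_div, ← Finset.sum_div, div_pow,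
        Finset.sum_sub_distrib]
      simp only [Finset.sum_const, Finset.card_univ, Fintype.card_fin, nsmul_eq_mul, ← pow_two]
      field_simp
    rw [e, abs_mul, abs_of_nonneg (by positivity : 0 ≤ m / ‖M‖ ^ 2)]
    calc ε * m = m / ‖M‖ ^ 2 * (ε * ‖M‖ ^ 2) := by field_simp
      _ < _ := mul_lt_mul_of_pos_left ha (by positivity)

/-- Polarization. Weighting `M` and `N` by each other's norm balances them: `‖U‖² + ‖V‖² = 4 (‖M‖
‖N‖)²`, so nothing is lost when the norms are very different. -/
lemma gram_tail (hm : 0 < m) (M N : EuclideanSpace ℝ κ) {ε : ℝ} (hε : 0 ≤ ε) (hε2 : ε ≤ 2) :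
    (gaussianPi (Fin m × κ)).real {a | ε * (‖M‖ * ‖N‖) < |gram a M N - inner ℝ M N|} ≤
      4 * Real.exp (-(m * ε ^ 2 / 16)) := by
  by_cases hM : M = 0
  · subst hM
    simp [gram]
    positivity
  by_cases hN : N = 0
  · subst hN
    simp [gram]
    positivity
  have hM0 : 0 < ‖M‖ := norm_pos_iff.2 hM
  have hN0 : 0 < ‖N‖ := norm_pos_iff.2 hN
  set U := ‖N‖ • M + ‖M‖ • N with hU
  set V := ‖N‖ • M + (-‖M‖) • N with hV
  have h1 := gram_self_tail hm U hε hε2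
  have h2 := gram_self_tail hm V hε hε2
  refine le_trans (measureReal_mono (s₂ := {a | ε * ‖U‖ ^ 2 < |gram a U U - ‖U‖ ^ 2|} ∪
      {a | ε * ‖V‖ ^ 2 < |gram a V V - ‖V‖ ^ 2|}) ?_)
    ((measureReal_union_le _ _).trans (by linarith))
  intro a ha
  simp only [Set.mem_ofPred_eq, Set.mem_union] at ha ⊢
  by_contra! hcon
  obtain ⟨hu, hv⟩ := hcon
  have nU : ‖U‖ ^ 2 = 2 * (‖M‖ * ‖N‖) ^ 2 + 2 * (‖M‖ * ‖N‖) * inner ℝ M N := by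
    rw [hU, norm_add_sq_real, norm_smul, norm_smul, inner_smul_left, inner_smul_right]
    simp
    ring
  have nV : ‖V‖ ^ 2 = 2 * (‖M‖ * ‖N‖) ^ 2 - 2 * (‖M‖ * ‖N‖) * inner ℝ M N := by
    rw [hV, norm_add_sq_real, norm_smul, norm_smul, inner_smul_left, inner_smul_right]
    simp
    ring
  have gUV : gram a U U - gram a V V = 4 * (‖M‖ * ‖N‖) * gram a M N := by
    simp only [hU, hV, gram_add_left, gram_add_right, gram_smul_left, gram_smul_right,
      gram_comm a N M]
    ring
  have hP : 0 < ‖M‖ * ‖N‖ := by positivity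
  have key : 4 * (‖M‖ * ‖N‖) * |gram a M N - inner ℝ M N| ≤
      4 * (‖M‖ * ‖N‖) * (ε * (‖M‖ * ‖N‖)) := by
    rw [← abs_of_pos (by positivity : 0 < 4 * (‖M‖ * ‖N‖)), ← abs_mul,
      abs_of_pos (by positivity : 0 < 4 * (‖M‖ * ‖N‖))]
    have e : 4 * (‖M‖ * ‖N‖) * (gram a M N - inner ℝ M N) =
        (gram a U U - ‖U‖ ^ 2) - (gram a V V - ‖V‖ ^ 2) := by
      rw [nU, nV]
      linear_combination -gUV
    rw [e]
    refine (abs_sub _ _).trans ((add_le_add hu hv).trans (le_of_eq ?_))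
    rw [nU, nV]
    ring
  exact absurd (le_of_mul_le_mul_left key (by positivity)) (not_le.2 ha)

end Concentration

/-! ### Restricted isometry from a coordinate grid -/

section RestrictedIsometry

variable {κ : Type*} {m : ℕ}

/-- `v` vanishes outside `K`. -/
def SupportedOn (K : Finset κ) (v : EuclideanSpace ℝ κ) : Prop :=
  ∀ p, p ∉ K → v p = 0

lemma SupportedOn.sub {K : Finset κ} {v w : EuclideanSpace ℝ κ} (hv : SupportedOn K v)
    (hw : SupportedOn K w) : SupportedOn K (v - w) := fun p hp => by
  simp [hv p hp, hw p hp]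

lemma SupportedOn.add {K : Finset κ} {v w : EuclideanSpace ℝ κ} (hv : SupportedOn K v)
    (hw : SupportedOn K w) : SupportedOn K (v + w) := fun p hp => by
  simp [hv p hp, hw p hp]

lemma SupportedOn.smul {K : Finset κ} {v : EuclideanSpace ℝ κ} (hv : SupportedOn K v) (r : ℝ) :
    SupportedOn K (r • v) := fun p hp => by
  simp [hv p hp]

/-- The map `C ↦ 25/16 δ + 9/16 C` contracts to `25/7 δ ≤ 4δ`, so any finite initial constant can be
iterated away. -/
lemma abs_le_of_self_improving {E : Type*} [NormedAddCommGroup E] (D : E → E → ℝ) (V : Set E)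
    {δ C : ℝ} (hδ : 0 ≤ δ) (hC : 0 ≤ C) (h0 : ∀ M ∈ V, ∀ N ∈ V, |D M N| ≤ C * (‖M‖ * ‖N‖))
    (hstep : ∀ C, 0 ≤ C → (∀ M ∈ V, ∀ N ∈ V, |D M N| ≤ C * (‖M‖ * ‖N‖)) →
      ∀ M ∈ V, ∀ N ∈ V, |D M N| ≤ (25 / 16 * δ + 9 / 16 * C) * (‖M‖ * ‖N‖)) :
    ∀ M ∈ V, ∀ N ∈ V, |D M N| ≤ 4 * δ * (‖M‖ * ‖N‖) := by
  have key : ∀ j : ℕ, ∀ M ∈ V, ∀ N ∈ V, |D M N| ≤ (4 * δ + (9 / 16) ^ j * C) * (‖M‖ * ‖N‖) := by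
    intro j
    induction j with
    | zero =>
      intro M hM N hN
      refine (h0 M hM N hN).trans ?_
      gcongr
      simp [hδ]
    | succ j ih =>
      intro M hM N hN
      refine (hstep _ (by positivity) ih M hM N hN).trans
        (mul_le_mul_of_nonneg_right ?_ (by positivity))
      rw [pow_succ]
      linarith
  intro M hM N hN
  have hlim : Filter.Tendsto (fun j : ℕ => (4 * δ + (9 / 16 : ℝ) ^ j * C) * (‖M‖ * ‖N‖))
      Filter.atTop (nhds ((4 * δ + 0 * C) * (‖M‖ * ‖N‖))) :=
    (((tendsto_pow_atTop_nhds_zero_of_lt_one (by norm_num) (by norm_num)).mul_const C).const_add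
      _).mul_const _
  have := ge_of_tendsto' hlim fun j => key j M hM N hN
  simpa using this

section Grid

variable [DecidableEq κ]

/-- The point of the grid `(1/L) ℤ ∩ [-1, 1]` in each coordinate of `K`, with index `f`. -/
def gridPoint (K : Finset κ) (L : ℕ) (f : K → Fin (2 * L + 1)) : EuclideanSpace ℝ κ :=
  WithLp.toLp 2 fun p => if h : p ∈ K then ((f ⟨p, h⟩ : ℕ) - (L : ℝ)) / L else 0

lemma supportedOn_gridPoint (K : Finset κ) (L : ℕ) (f : K → Fin (2 * L + 1)) :
    SupportedOn K (gridPoint K L f) := fun p hp => by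
  simp [gridPoint, hp]

end Grid

variable [Fintype κ]

/-- The empirical second moment form is `δ`-close to the inner product on vectors supported
on `K`. -/
def IsRIP (a : Fin m × κ → ℝ) (K : Finset κ) (δ : ℝ) : Prop :=
  ∀ M N : EuclideanSpace ℝ κ, SupportedOn K M → SupportedOn K N →
    |gram a M N - inner ℝ M N| ≤ δ * (‖M‖ * ‖N‖)

/-- A crude, data-dependent constant, needed only as a finite starting point for
`abs_le_of_self_improving`. -/
lemma abs_gram_sub_inner_le (a : Fin m × κ → ℝ) (M N : EuclideanSpace ℝ κ) :
    |gram a M N - inner ℝ M N| ≤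
      ((1 / (m : ℝ)) * ∑ i, ‖row a i‖ ^ 2 + 1) * (‖M‖ * ‖N‖) := by
  have h1 : |gram a M N| ≤ ((1 / (m : ℝ)) * ∑ i, ‖row a i‖ ^ 2) * (‖M‖ * ‖N‖) := by
    rw [gram, abs_mul, abs_of_nonneg (by positivity : 0 ≤ 1 / (m : ℝ)), mul_assoc]
    gcongr
    rw [Finset.sum_mul]
    refine (Finset.abs_sum_le_sum_abs _ _).trans (Finset.sum_le_sum fun i _ => ?_)
    rw [abs_mul]
    calc _ ≤ (‖row a i‖ * ‖M‖) * (‖row a i‖ * ‖N‖) :=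
          mul_le_mul (abs_real_inner_le_norm _ _) (abs_real_inner_le_norm _ _) (abs_nonneg _)
            (by positivity)
      _ = _ := by ring
  have h2 := abs_real_inner_le_norm M N
  calc _ ≤ |gram a M N| + |inner ℝ M N| := abs_sub _ _
    _ ≤ _ := by linarith

variable [DecidableEq κ]

/-- Round every coordinate in `K` down to a multiple of `1/L`: the squared error is at most `|K| /
L² ≤ 1/16`. -/
lemma exists_gridPoint_near {K : Finset κ} {L : ℕ} (hL : 0 < L) (hLK : 16 * K.card ≤ L ^ 2)
    {M : EuclideanSpace ℝ κ} (hM : SupportedOn K M) (hM1 : ‖M‖ ≤ 1) :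
    ∃ f, ‖M - gridPoint K L f‖ ≤ 1 / 4 := by
  have hL0 : (0 : ℝ) < L := Nat.cast_pos.2 hL
  have hc : ∀ p, |M p| ≤ 1 := fun p => by
    have := PiLp.norm_apply_le M p
    rw [Real.norm_eq_abs] at this
    exact this.trans hM1
  have hex : ∀ p, ∃ j : Fin (2 * L + 1), |M p - ((j : ℕ) - (L : ℝ)) / L| ≤ 1 / L := by
    intro p
    obtain ⟨h1, h2⟩ := abs_le.1 (hc p)
    have hnn : 0 ≤ L * M p + L := by nlinarith
    have hle : ⌊L * M p + L⌋₊ < 2 * L + 1 := by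
      rw [Nat.floor_lt hnn]
      push_cast
      nlinarith
    refine ⟨⟨⌊L * M p + L⌋₊, hle⟩, ?_⟩
    have e : M p - ((⌊L * M p + L⌋₊ : ℝ) - L) / L = (L * M p + L - ⌊L * M p + L⌋₊) / L := by
      field_simp
      ring
    have h3 := Nat.floor_le hnn
    have h4 := Nat.lt_floor_add_one (L * M p + L)
    simp only
    rw [e, abs_div, abs_of_pos hL0]
    gcongr
    rw [abs_le]
    constructor <;> linarith
  choose j hj using hex
  refine ⟨fun p => j p, ?_⟩
  have hsq : ‖M - gridPoint K L fun p => j p‖ ^ 2 ≤ (1 / 4) ^ 2 := by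
    rw [EuclideanSpace.norm_sq_eq]
    calc ∑ p, ‖(M - gridPoint K L fun p => j p) p‖ ^ 2
        ≤ ∑ p, if p ∈ K then (1 / (L : ℝ)) ^ 2 else 0 := by
          refine Finset.sum_le_sum fun p _ => ?_
          by_cases hp : p ∈ K
          · simp only [hp, if_true, PiLp.sub_apply, gridPoint, dif_pos, Real.norm_eq_abs]
            exact pow_le_pow_left₀ (abs_nonneg _) (hj p) 2
          · simp [hp, gridPoint, hM p hp]
      _ = K.card * (1 / (L : ℝ)) ^ 2 := by
          rw [← Finset.sum_filter]
          simp
      _ ≤ _ := by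
          have : (16 * K.card : ℝ) ≤ (L : ℝ) ^ 2 := by exact_mod_cast hLK
          rw [one_div, inv_pow, ← div_eq_mul_inv, div_le_iff₀ (by positivity)]
          linarith
  exact le_of_sq_le_sq hsq (by norm_num)

/-- For unit `M`, `N` with grid points `F`, `G` within `1/4`, write `D M N = D F G + D (M - F) N + D
F (N - G)`. Since `‖F‖, ‖G‖ ≤ 5/4`, the first term costs `(5/4)² δ` and the others `(1/4 + 5/16) C =
9/16 C`. -/
lemma isRIP_of_gridPoint {a : Fin m × κ → ℝ} {K : Finset κ} {L : ℕ} {δ : ℝ} (hL : 0 < L)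
    (hLK : 16 * K.card ≤ L ^ 2) (hδ : 0 ≤ δ)
    (h : ∀ f g, |gram a (gridPoint K L f) (gridPoint K L g) -
        inner ℝ (gridPoint K L f) (gridPoint K L g)| ≤
      δ * (‖gridPoint K L f‖ * ‖gridPoint K L g‖)) :
    IsRIP a K (4 * δ) := by
  set D : EuclideanSpace ℝ κ → EuclideanSpace ℝ κ → ℝ := fun M N => gram a M N - inner ℝ M N
    with hD
  have Dadd_left : ∀ M M' N, D (M + M') N = D M N + D M' N := fun M M' N => by
    simp only [hD, gram_add_left, inner_add_left]; ring
  have Dadd_right : ∀ M N N', D M (N + N') = D M N + D M N' := fun M N N' => by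
    simp only [hD, gram_add_right, inner_add_right]; ring
  have Dsmul : ∀ (r s : ℝ) M N, D (r • M) (s • N) = r * s * D M N := fun r s M N => by
    simp only [hD, gram_smul_left, gram_smul_right, inner_smul_left, inner_smul_right]
    simp
    ring
  have main := abs_le_of_self_improving D {M | SupportedOn K M} hδ
    (by positivity : 0 ≤ (1 / (m : ℝ)) * ∑ i, ‖row a i‖ ^ 2 + 1)
    (fun M _ N _ => abs_gram_sub_inner_le a M N) ?_
  · exact fun M N hM hN => main M hM N hN
  intro C hC hCD
  have hunit : ∀ M N, SupportedOn K M → SupportedOn K N → ‖M‖ = 1 → ‖N‖ = 1 →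
      |D M N| ≤ 25 / 16 * δ + 9 / 16 * C := by
    intro M N hM hN hM1 hN1
    obtain ⟨f, hf⟩ := exists_gridPoint_near hL hLK hM hM1.le
    obtain ⟨g, hg⟩ := exists_gridPoint_near hL hLK hN hN1.le
    set F := gridPoint K L f
    set G := gridPoint K L g
    have hFs : SupportedOn K F := supportedOn_gridPoint K L f
    have hGs : SupportedOn K G := supportedOn_gridPoint K L g
    have hF : ‖F‖ ≤ 5 / 4 := by
      have := norm_sub_norm_le F M
      rw [norm_sub_rev] at this
      linarith
    have hG : ‖G‖ ≤ 5 / 4 := by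
      have := norm_sub_norm_le G N
      rw [norm_sub_rev] at this
      linarith
    have e : D M N = D F G + D (M - F) N + D F (N - G) := by
      have h1 := Dadd_left (M - F) F N
      have h2 := Dadd_right F (N - G) G
      rw [sub_add_cancel] at h1 h2
      rw [h1, h2]
      ring
    have b1 : |D F G| ≤ 25 / 16 * δ := by
      refine (h f g).trans ?_
      have : ‖F‖ * ‖G‖ ≤ 5 / 4 * (5 / 4) := by gcongr
      nlinarith
    have b2 : |D (M - F) N| ≤ C * (1 / 4) := by
      refine (hCD _ (hM.sub hFs) _ hN).trans ?_
      rw [hN1, mul_one]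
      gcongr
    have b3 : |D F (N - G)| ≤ C * (5 / 4 * (1 / 4)) := by
      refine (hCD _ hFs _ (hN.sub hGs)).trans ?_
      gcongr
    rw [e]
    calc _ ≤ |D F G| + |D (M - F) N| + |D F (N - G)| := abs_add_three _ _ _
      _ ≤ _ := by linarith
  intro M hM N hN
  by_cases hM0 : M = 0
  · subst hM0
    simpa using hCD 0 hM N hN
  by_cases hN0 : N = 0
  · subst hN0
    simpa using hCD M hM 0 hN
  have nM : 0 < ‖M‖ := norm_pos_iff.2 hM0
  have nN : 0 < ‖N‖ := norm_pos_iff.2 hN0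
  have hu := hunit (‖M‖⁻¹ • M) (‖N‖⁻¹ • N) (SupportedOn.smul hM _) (SupportedOn.smul hN _)
    (by rw [norm_smul, norm_inv, norm_norm, inv_mul_cancel₀ nM.ne'])
    (by rw [norm_smul, norm_inv, norm_norm, inv_mul_cancel₀ nN.ne'])
  rw [Dsmul, abs_mul, abs_of_pos (by positivity), ← mul_inv, inv_mul_le_iff₀ (by positivity)] at hu
  linarith

/-- The restricted isometry property holds with overwhelming probability. -/
lemma isRIP_probability (hm : 0 < m) (K : Finset κ) {L : ℕ} (hL : 0 < L)
    (hLK : 16 * K.card ≤ L ^ 2) {δ : ℝ} (hδ : 0 ≤ δ) (hδ2 : δ ≤ 2) :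
    (gaussianPi (Fin m × κ)).real {a | ¬ IsRIP a K (4 * δ)} ≤
      4 * (2 * L + 1) ^ (2 * K.card) * Real.exp (-(m * δ ^ 2 / 16)) := by
  have hsub : {a : Fin m × κ → ℝ | ¬ IsRIP a K (4 * δ)} ⊆
      ⋃ q : (K → Fin (2 * L + 1)) × (K → Fin (2 * L + 1)),
        {a | δ * (‖gridPoint K L q.1‖ * ‖gridPoint K L q.2‖) <
          |gram a (gridPoint K L q.1) (gridPoint K L q.2) -
            inner ℝ (gridPoint K L q.1) (gridPoint K L q.2)|} := by
    intro a ha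
    by_contra hcon
    refine ha (isRIP_of_gridPoint hL hLK hδ fun f g => ?_)
    simp only [Set.mem_iUnion, Set.mem_ofPred_eq, not_exists, not_lt] at hcon
    exact hcon (f, g)
  refine (measureReal_mono hsub).trans ((measureReal_iUnion_fintype_le _).trans ?_)
  refine (Finset.sum_le_sum fun q _ => gram_tail hm _ _ hδ hδ2).trans ?_
  rw [Finset.sum_const, Finset.card_univ, Fintype.card_prod, Fintype.card_fun, Fintype.card_fin,
    Fintype.card_coe, nsmul_eq_mul]
  push_cast
  rw [two_mul K.card, pow_add]
  exact le_of_eq (by ring)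

end RestrictedIsometry

/-! ### The algorithm expressed through the empirical form on rank-one matrices -/

section Tensor

variable {n m : ℕ}

/-- The rank-one matrix `w zᵀ` as a Euclidean vector. -/
def tensor (w z : EuclideanSpace ℝ (Fin n)) : EuclideanSpace ℝ (Fin n × Fin n) :=
  WithLp.toLp 2 fun p => w p.1 * z p.2

@[simp] lemma tensor_apply (w z : EuclideanSpace ℝ (Fin n)) (p : Fin n × Fin n) :
    tensor w z p = w p.1 * z p.2 := rfl

lemma inner_tensor (w z w' z' : EuclideanSpace ℝ (Fin n)) :
    inner ℝ (tensor w z) (tensor w' z') = inner ℝ w w' * inner ℝ z z' := by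
  simp only [PiLp.inner_apply, tensor_apply, Fintype.sum_prod_type, Finset.sum_mul_sum]
  refine Finset.sum_congr rfl fun j _ => Finset.sum_congr rfl fun l _ => ?_
  simp
  ring

lemma norm_tensor (w z : EuclideanSpace ℝ (Fin n)) : ‖tensor w z‖ = ‖w‖ * ‖z‖ := by
  have h : ‖tensor w z‖ ^ 2 = (‖w‖ * ‖z‖) ^ 2 := by
    rw [← real_inner_self_eq_norm_sq, inner_tensor, real_inner_self_eq_norm_sq,
      real_inner_self_eq_norm_sq]
    ring
  exact (pow_left_inj₀ (norm_nonneg _) (by positivity) two_ne_zero).1 h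

lemma supportedOn_tensor {S : Finset (Fin n)} {w z : EuclideanSpace ℝ (Fin n)}
    (hw : SupportedOn S w) (hz : SupportedOn S z) : SupportedOn (S ×ˢ S) (tensor w z) := by
  intro p hp
  rw [Finset.mem_product, not_and_or] at hp
  rcases hp with h | h
  · simp [hw _ h]
  · simp [hz _ h]

/-- The symmetrized rank-one matrix `(w zᵀ + z wᵀ) / 2`. -/
def symTensor (w z : EuclideanSpace ℝ (Fin n)) : EuclideanSpace ℝ (Fin n × Fin n) :=
  (1 / 2 : ℝ) • (tensor w z + tensor z w)

lemma norm_symTensor_le (w z : EuclideanSpace ℝ (Fin n)) : ‖symTensor w z‖ ≤ ‖w‖ * ‖z‖ := by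
  rw [symTensor, norm_smul]
  have := norm_add_le (tensor w z) (tensor z w)
  rw [norm_tensor, norm_tensor] at this
  norm_num
  linarith

lemma supportedOn_symTensor {S : Finset (Fin n)} {w z : EuclideanSpace ℝ (Fin n)}
    (hw : SupportedOn S w) (hz : SupportedOn S z) : SupportedOn (S ×ˢ S) (symTensor w z) :=
  ((supportedOn_tensor hw hz).add (supportedOn_tensor hz hw)).smul _

lemma inner_tensor_self_symTensor (x w z : EuclideanSpace ℝ (Fin n)) :
    inner ℝ (tensor x x) (symTensor w z) = inner ℝ x w * inner ℝ x z := by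
  rw [symTensor, inner_smul_right, inner_add_right, inner_tensor, inner_tensor]
  ring

/-- The measurement matrices encoded by a data array. -/
def arr (a : Fin m × Fin n × Fin n → ℝ) (i : Fin m) : Matrix (Fin n) (Fin n) ℝ :=
  Matrix.of fun j l => a (i, j, l)

@[simp] lemma arr_apply (a : Fin m × Fin n × Fin n → ℝ) (i : Fin m) (j l : Fin n) :
    arr a i j l = a (i, j, l) := rfl

lemma inner_row_tensor (a : Fin m × Fin n × Fin n → ℝ) (i : Fin m)
    (w z : EuclideanSpace ℝ (Fin n)) :
    inner ℝ (row a i) (tensor w z) = w.ofLp ⬝ᵥ (arr a i *ᵥ z.ofLp) := by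
  rw [inner_row, Fintype.sum_prod_type]
  simp only [dotProduct, Matrix.mulVec, Finset.mul_sum, tensor_apply, arr_apply]
  refine Finset.sum_congr rfl fun j _ => Finset.sum_congr rfl fun l _ => ?_
  ring

lemma quad_arr (a : Fin m × Fin n × Fin n → ℝ) (i : Fin m) (z : EuclideanSpace ℝ (Fin n)) :
    quad (arr a i) z = inner ℝ (row a i) (tensor z z) := (inner_row_tensor a i z z).symm

lemma inner_symPart_mulVec (a : Fin m × Fin n × Fin n → ℝ) (i : Fin m)
    (w z : EuclideanSpace ℝ (Fin n)) :
    inner ℝ (WithLp.toLp 2 (symPart (arr a i) *ᵥ z.ofLp)) w =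
      inner ℝ (row a i) (symTensor w z) := by
  rw [symTensor, inner_smul_right, inner_add_right, inner_row_tensor, inner_row_tensor,
    EuclideanSpace.inner_eq_star_dotProduct]
  simp only [symPart, Matrix.smul_mulVec, Matrix.add_mulVec, star_trivial, dotProduct_smul,
    dotProduct_add, smul_eq_mul]
  congr 2
  rw [Matrix.mulVec_transpose, Matrix.dotProduct_mulVec, dotProduct_comm]

/-- The observations produced by the signal `x`. -/
def obs (a : Fin m × Fin n × Fin n → ℝ) (x : EuclideanSpace ℝ (Fin n)) (i : Fin m) : ℝ :=
  quad (arr a i) x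

/-- This makes the gradient accessible both to the restricted isometry (when `w` and `z` live on
`S`) and to the conditional Gaussian bound (when `w` is a basis vector outside `S`). -/
lemma inner_grad (a : Fin m × Fin n × Fin n → ℝ) (x z w : EuclideanSpace ℝ (Fin n)) :
    inner ℝ (grad (arr a) (obs a x) z) w =
      gram a (tensor z z - tensor x x) (symTensor w z) := by
  simp only [grad, inner_smul_left, sum_inner, gram, inner_symPart_mulVec, obs, quad_arr,
    inner_sub_right]
  simp

lemma level_eq (β : ℝ) (a : Fin m × Fin n × Fin n → ℝ) (x z : EuclideanSpace ℝ (Fin n)) :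
    level β (arr a) (obs a x) z =
      √(β / m * gram a (tensor z z - tensor x x) (tensor z z - tensor x x)) * ‖z‖ := by
  simp only [level, gram, obs, quad_arr, inner_sub_right, ← pow_two]
  congr 2
  ring

lemma gram_self_nonneg {κ : Type*} [Fintype κ] (a : Fin m × κ → ℝ) (M : EuclideanSpace ℝ κ) :
    0 ≤ gram a M M := by
  simp only [gram, ← pow_two]
  positivity

lemma phi_nonneg (y : Fin m → ℝ) : 0 ≤ phi y := by
  unfold phi
  positivity

lemma phi_pow_four (a : Fin m × Fin n × Fin n → ℝ) (x : EuclideanSpace ℝ (Fin n)) :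
    phi (obs a x) ^ 4 = gram a (tensor x x) (tensor x x) := by
  have h := gram_self_nonneg a (tensor x x)
  have : phi (obs a x) = gram a (tensor x x) (tensor x x) ^ (1 / 4 : ℝ) := by
    simp only [phi, gram, obs, quad_arr, ← pow_two]
  rw [this, ← Real.rpow_natCast, ← Real.rpow_mul h]
  norm_num

lemma diagStat_eq (a : Fin m × Fin n × Fin n → ℝ) (x : EuclideanSpace ℝ (Fin n)) (l : Fin n) :
    diagStat (arr a) (obs a x) l = gram a (tensor x x)
      (tensor (EuclideanSpace.single l 1) (EuclideanSpace.single l 1)) := by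
  simp only [diagStat, gram, obs, quad_arr]
  congr 1
  refine Finset.sum_congr rfl fun i _ => ?_
  congr 1
  rw [inner_row_tensor]
  simp

/-- Coordinate projection onto `S`. -/
def coordProj (S : Finset (Fin n)) (w : EuclideanSpace ℝ (Fin n)) : EuclideanSpace ℝ (Fin n) :=
  WithLp.toLp 2 fun j => if j ∈ S then w j else 0

lemma supportedOn_coordProj {S S' : Finset (Fin n)} (h : S ⊆ S') (w : EuclideanSpace ℝ (Fin n)) :
    SupportedOn S' (coordProj S w) := fun j hj => by
  have : j ∉ S := fun h' => hj (h h')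
  simp [coordProj, this]

lemma norm_coordProj_le (S : Finset (Fin n)) (w : EuclideanSpace ℝ (Fin n)) :
    ‖coordProj S w‖ ≤ ‖w‖ := by
  refine le_of_sq_le_sq ?_ (norm_nonneg _)
  rw [EuclideanSpace.norm_sq_eq, EuclideanSpace.norm_sq_eq]
  refine Finset.sum_le_sum fun j _ => ?_
  by_cases h : j ∈ S
  · simp [coordProj, h]
  · simp [coordProj, h]
    positivity

lemma inner_coordProj (S : Finset (Fin n)) (v w : EuclideanSpace ℝ (Fin n)) :
    inner ℝ v (coordProj S w) = inner ℝ (coordProj S v) w := by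
  simp only [PiLp.inner_apply, coordProj]
  refine Finset.sum_congr rfl fun j _ => ?_
  by_cases h : j ∈ S <;> simp [h]

lemma symPart_isSymm (M : Matrix (Fin n) (Fin n) ℝ) : (symPart M)ᵀ = symPart M := by
  rw [symPart, Matrix.transpose_smul, Matrix.transpose_add, Matrix.transpose_transpose, add_comm]

lemma restrict_isSymm (S : Finset (Fin n)) {M : Matrix (Fin n) (Fin n) ℝ} (hM : Mᵀ = M) :
    (restrict S M)ᵀ = restrict S M := by
  ext j l
  have : M l j = M j l := congrFun (congrFun hM j) l
  simp only [Matrix.transpose_apply, restrict, Matrix.of_apply, this, and_comm]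

lemma inner_restrict_mulVec (S : Finset (Fin n)) (M : Matrix (Fin n) (Fin n) ℝ)
    (w v : EuclideanSpace ℝ (Fin n)) :
    inner ℝ w (WithLp.toLp 2 (restrict S M *ᵥ v.ofLp)) =
      inner ℝ (coordProj S w) (WithLp.toLp 2 (M *ᵥ (coordProj S v).ofLp)) := by
  simp only [PiLp.inner_apply, Matrix.mulVec, dotProduct, restrict, Matrix.of_apply, coordProj]
  refine Finset.sum_congr rfl fun j _ => ?_
  by_cases h : j ∈ S
  · simp only [h, true_and, if_true]
    congr 1
    refine Finset.sum_congr rfl fun l _ => ?_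
    by_cases h' : l ∈ S <;> simp [h']
  · simp [h]

lemma inner_symPart_dataMatrix_mulVec (a : Fin m × Fin n × Fin n → ℝ)
    (x w v : EuclideanSpace ℝ (Fin n)) :
    inner ℝ w (WithLp.toLp 2 (symPart (dataMatrix (arr a) (obs a x)) *ᵥ v.ofLp)) =
      gram a (tensor x x) (symTensor w v) := by
  have e : symPart (dataMatrix (arr a) (obs a x)) =
      (1 / (m : ℝ)) • ∑ i, obs a x i • symPart (arr a i) := by
    simp only [symPart, dataMatrix, Matrix.transpose_smul, Matrix.transpose_sum, ← smul_add,
      ← Finset.sum_add_distrib, Finset.smul_sum]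
    refine Finset.sum_congr rfl fun i _ => ?_
    simp only [smul_smul]
    congr 1
    ring
  rw [e, Matrix.smul_mulVec, Matrix.sum_mulVec, WithLp.toLp_smul, WithLp.toLp_sum,
    inner_smul_right, inner_sum, gram]
  congr 1
  refine Finset.sum_congr rfl fun i _ => ?_
  rw [Matrix.smul_mulVec, WithLp.toLp_smul, inner_smul_right, real_inner_comm,
    inner_symPart_mulVec, obs, quad_arr]

end Tensor

/-! ### Local contraction of a thresholded gradient step -/

section Contraction

variable {n m : ℕ}

lemma abs_threshold_sub_le {𝒯 : ℝ → ℝ → ℝ} (h𝒯 : IsThresholding 𝒯) {τ : ℝ} (hτ : 0 ≤ τ) (r : ℝ) :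
    |𝒯 τ r - r| ≤ τ := by
  rcases le_or_gt |r| τ with h | h
  · rw [(h𝒯 τ hτ r).1 h, zero_sub, abs_neg]
    exact h
  · exact (h𝒯 τ hτ r).2 h

/-- One exact population gradient step contracts towards `x`. -/
lemma norm_population_step_le {x h : EuclideanSpace ℝ (Fin n)} (hx : ‖x‖ = 1) (hh : ‖h‖ ≤ 1)
    {ν : ℝ} (hν : 0 ≤ ν) (hν2 : ν ≤ 1 / 2) :
    ‖h - ν • (‖x + h‖ ^ 2 • (x + h) - inner ℝ x (x + h) • x)‖ ≤
      (1 - ν) * ‖h‖ + ν * (4 * ‖h‖ ^ 2) := by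
  set p := inner ℝ x h with hp
  set q := ‖h‖ ^ 2 with hq
  have hpq : p ^ 2 ≤ q := by
    have := abs_real_inner_le_norm x h
    rw [hx, one_mul] at this
    rw [← sq_abs]
    exact pow_le_pow_left₀ (abs_nonneg _) this 2
  have hpa : |p| ≤ ‖h‖ := by
    have := abs_real_inner_le_norm x h
    rwa [hx, one_mul] at this
  have hq0 : 0 ≤ q := sq_nonneg _
  have hqh : q ≤ ‖h‖ := by rw [hq]; nlinarith [norm_nonneg h]
  have e1 : ‖x + h‖ ^ 2 = 1 + 2 * p + q := by
    rw [norm_add_sq_real, hx]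
    ring
  have e2 : inner ℝ x (x + h) = 1 + p := by
    rw [inner_add_right, real_inner_self_eq_norm_sq, hx]
    ring
  -- Linear part minus quadratic remainder. The linear map scales the direction of `x` by `1 - 2ν`
  -- and its orthogonal complement by `1 - ν`.
  have e3 : h - ν • (‖x + h‖ ^ 2 • (x + h) - inner ℝ x (x + h) • x) =
      ((1 - ν) • h - (ν * p) • x) - ν • (q • x + (2 * p + q) • h) := by
    rw [e1, e2]
    module
  have n1 : ‖(1 - ν) • h - (ν * p) • x‖ ≤ (1 - ν) * ‖h‖ := by
    refine le_of_sq_le_sq ?_ (mul_nonneg (by linarith) (norm_nonneg _))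
    rw [norm_sub_sq_real, norm_smul, norm_smul, inner_smul_left, inner_smul_right, hx,
      real_inner_comm, ← hp, Real.norm_eq_abs, Real.norm_eq_abs, mul_pow, mul_one, sq_abs, sq_abs]
    simp only [conj_trivial]
    nlinarith [mul_nonneg (mul_nonneg hν (by linarith : 0 ≤ 2 - 3 * ν)) (sq_nonneg p)]
  have n2 : ‖q • x + (2 * p + q) • h‖ ≤ 4 * q := by
    refine (norm_add_le _ _).trans ?_
    rw [norm_smul, norm_smul, hx, Real.norm_eq_abs, Real.norm_eq_abs, abs_of_nonneg hq0, mul_one]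
    have : |2 * p + q| ≤ 3 * ‖h‖ := by
      refine (abs_add_le _ _).trans ?_
      rw [abs_mul, abs_two, abs_of_nonneg hq0]
      linarith
    have h3 : |2 * p + q| * ‖h‖ ≤ 3 * ‖h‖ * ‖h‖ := by gcongr
    have : 3 * ‖h‖ * ‖h‖ = 3 * q := by rw [hq]; ring
    linarith
  rw [e3]
  refine (norm_sub_le _ _).trans (add_le_add n1 ?_)
  rw [norm_smul, Real.norm_eq_abs, abs_of_nonneg hν]
  gcongr

lemma norm_tensor_sub_tensor_le (x z : EuclideanSpace ℝ (Fin n)) :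
    ‖tensor z z - tensor x x‖ ≤ (‖z‖ + ‖x‖) * ‖z - x‖ := by
  have e : tensor z z - tensor x x = tensor (z - x) z + tensor x (z - x) := by
    ext p
    simp
    ring
  rw [e]
  refine (norm_add_le _ _).trans ?_
  rw [norm_tensor, norm_tensor]
  exact le_of_eq (by ring)

/-- Replacing `gram` by its expectation in `inner_grad` identifies the population gradient `‖z‖² z -
⟪x, z⟫ x`. -/
lemma inner_tensor_sub_symTensor (x z w : EuclideanSpace ℝ (Fin n)) :
    inner ℝ (tensor z z - tensor x x) (symTensor w z) =
      inner ℝ (‖z‖ ^ 2 • z - inner ℝ x z • x) w := by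
  rw [inner_sub_left, inner_tensor_self_symTensor, inner_tensor_self_symTensor, inner_sub_left,
    inner_smul_left, inner_smul_left, real_inner_self_eq_norm_sq]
  simp
  ring

lemma phi_bounds {a : Fin m × Fin n × Fin n → ℝ} {x : EuclideanSpace ℝ (Fin n)}
    {S : Finset (Fin n)} {δ : ℝ} (hrip : IsRIP a (S ×ˢ S) δ) (hδ : δ ≤ 1 / 2) (hx : ‖x‖ = 1)
    (hxS : SupportedOn S x) :
    |phi (obs a x) - 1| ≤ δ ∧ 1 / 2 ≤ phi (obs a x) ^ 2 ∧ phi (obs a x) ^ 2 ≤ 2 := by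
  have hT := supportedOn_tensor hxS hxS
  have h := hrip _ _ hT hT
  rw [← phi_pow_four, inner_tensor, norm_tensor, real_inner_self_eq_norm_sq, hx] at h
  norm_num at h
  obtain ⟨h1, h2⟩ := abs_le.1 h
  have h0 := phi_nonneg (obs a x)
  set φ := phi (obs a x)
  have hfac : φ ^ 4 - 1 = (φ - 1) * (φ ^ 3 + φ ^ 2 + φ + 1) := by ring
  refine ⟨?_, by nlinarith [sq_nonneg φ], by nlinarith [sq_nonneg φ]⟩
  refine le_trans ?_ h
  rw [hfac, abs_mul]
  refine le_mul_of_one_le_right (abs_nonneg _) ?_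
  rw [abs_of_nonneg (by positivity)]
  have : 0 ≤ φ ^ 3 + φ ^ 2 + φ := by positivity
  linarith

set_option maxHeartbeats 800000 in
/-- Local linear convergence of one thresholded gradient step that stays supported on `S`. -/
lemma norm_update_sub_le {𝒯 : ℝ → ℝ → ℝ} (h𝒯 : IsThresholding 𝒯)
    {a : Fin m × Fin n × Fin n → ℝ} {x z : EuclideanSpace ℝ (Fin n)} {S : Finset (Fin n)}
    {β μ : ℝ} (hrip : IsRIP a (S ×ˢ S) (1 / 100)) (hx : ‖x‖ = 1) (hxS : SupportedOn S x)
    (hzS : SupportedOn S z) (hz : ‖z - x‖ ≤ 1 / 20) (hμ : 0 < μ) (hμ1 : μ ≤ 1 / 4)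
    (hSβ : S.card * (β / m) ≤ 1 / 10000)
    (hup : SupportedOn S (update 𝒯 β μ (arr a) (obs a x) z)) :
    ‖update 𝒯 β μ (arr a) (obs a x) z - x‖ ≤ (1 - μ / 16) * ‖z - x‖ := by
  obtain ⟨-, hφ1, hφ2⟩ := phi_bounds hrip (by norm_num) hx hxS
  set φ := phi (obs a x) with hφ
  set ν := μ / φ ^ 2 with hν
  have hφpos : 0 < φ ^ 2 := by linarith
  have hν0 : 0 ≤ ν := by positivity
  have hν1 : ν ≤ 1 / 2 := by
    rw [hν, div_le_iff₀ hφpos]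
    linarith
  have hν2 : μ / 2 ≤ ν := by
    rw [hν, le_div_iff₀ hφpos]
    nlinarith
  set h := z - x with hh
  have hzn : ‖z‖ ≤ 21 / 20 := by
    have := norm_le_norm_add_norm_sub' z x
    linarith
  set H := tensor z z - tensor x x with hH
  have hHS : SupportedOn (S ×ˢ S) H :=
    (supportedOn_tensor hzS hzS).sub (supportedOn_tensor hxS hxS)
  have hHn : ‖H‖ ≤ 41 / 20 * ‖h‖ := by
    refine (norm_tensor_sub_tensor_le x z).trans ?_
    gcongr
    linarith
  set g0 := ‖z‖ ^ 2 • z - inner ℝ x z • x with hg0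
  set G := grad (arr a) (obs a x) z with hG
  set lev := level β (arr a) (obs a x) z with hlev
  have hlev0 : 0 ≤ lev := by
    rw [hlev, level]
    positivity
  set u := update 𝒯 β μ (arr a) (obs a x) z - x with hu
  have huS : SupportedOn S u := hup.sub hxS
  -- `√|S| * lev` bounds the Euclidean cost of thresholding on `S`. The level scales with the
  -- residual, hence with `‖h‖`, so the bias shrinks along with the error and convergence is to the
  -- signal itself.
  have hlevS : √S.card * lev ≤ 1 / 20 * ‖h‖ := by
    have hgram : gram a H H ≤ (41 / 20 * ‖h‖) ^ 2 * (101 / 100) := by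
      have h1 := (abs_le.1 (hrip _ _ hHS hHS)).2
      rw [real_inner_self_eq_norm_sq] at h1
      have : ‖H‖ ^ 2 ≤ (41 / 20 * ‖h‖) ^ 2 := by gcongr
      nlinarith
    have hg0 := gram_self_nonneg a H
    rw [hlev, level_eq, ← mul_assoc, ← Real.sqrt_mul (by positivity)]
    have : √(S.card * (β / m * gram a H H)) ≤ 1 / 40 * ‖h‖ := by
      refine Real.sqrt_le_iff.2 ⟨by positivity, ?_⟩
      rw [← mul_assoc]
      calc S.card * (β / m) * gram a H H
          ≤ 1 / 10000 * ((41 / 20 * ‖h‖) ^ 2 * (101 / 100)) := by gcongr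
        _ ≤ _ := by nlinarith [sq_nonneg ‖h‖]
    calc _ ≤ 1 / 40 * ‖h‖ * (21 / 20) := by gcongr
      _ ≤ _ := by nlinarith [norm_nonneg h]
  have hgrad : |inner ℝ (G - g0) u| ≤ 1 / 40 * ‖h‖ * ‖u‖ := by
    rw [inner_sub_left, hG, inner_grad, hg0, ← inner_tensor_sub_symTensor]
    refine (hrip _ _ hHS (supportedOn_symTensor huS hzS)).trans ?_
    have h1 := norm_symTensor_le u z
    calc _ ≤ 1 / 100 * ((41 / 20 * ‖h‖) * (‖u‖ * (21 / 20))) := by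
          gcongr
          exact h1.trans (by gcongr)
      _ ≤ _ := by nlinarith [mul_nonneg (norm_nonneg h) (norm_nonneg u)]
  have hpop : ‖h - ν • g0‖ ≤ (1 - ν) * ‖h‖ + ν * (4 * ‖h‖ ^ 2) := by
    have := norm_population_step_le (h := h) hx (by linarith) hν0 hν1
    rwa [hh, add_sub_cancel, ← hh, ← hg0] at this
  have hthr : |inner ℝ (u - (h - ν • G)) u| ≤ ν * lev * (√S.card * ‖u‖) := by
    have hcs : ∑ j ∈ S, |u j| ≤ √S.card * ‖u‖ := by
      have h1 : (∑ j ∈ S, |u j|) ^ 2 ≤ S.card * ∑ j ∈ S, |u j| ^ 2 := sq_sum_le_card_mul_sum_sq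
      have h2 : ∑ j ∈ S, |u j| ^ 2 ≤ ‖u‖ ^ 2 := by
        rw [EuclideanSpace.norm_sq_eq]
        exact Finset.sum_le_sum_of_subset_of_nonneg (Finset.subset_univ _)
          fun j _ _ => by positivity
      refine le_of_sq_le_sq ?_ (by positivity)
      rw [mul_pow, Real.sq_sqrt (by positivity)]
      exact h1.trans (by gcongr)
    have hterm : ∀ j, |(u - (h - ν • G)) j| ≤ ν * lev := by
      intro j
      have e : (u - (h - ν • G)) j = 𝒯 (ν * lev) (z j - ν * G j) - (z j - ν * G j) := by
        simp only [hu, hh, update, PiLp.sub_apply, PiLp.smul_apply, smul_eq_mul]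
        ring
      rw [e]
      exact abs_threshold_sub_le h𝒯 (by positivity) _
    have hsum : inner ℝ (u - (h - ν • G)) u = ∑ j ∈ S, u j * (u - (h - ν • G)) j := by
      rw [PiLp.inner_apply]
      symm
      refine Finset.sum_subset_zero_on_sdiff (Finset.subset_univ S) ?_ fun j _ => rfl
      intro j hj
      have : u j = 0 := huS j (Finset.mem_sdiff.1 hj).2
      simp [this]
    rw [hsum]
    refine (Finset.abs_sum_le_sum_abs _ _).trans ?_
    calc ∑ j ∈ S, |u j * (u - (h - ν • G)) j| ≤ ∑ j ∈ S, |u j| * (ν * lev) := by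
          refine Finset.sum_le_sum fun j _ => ?_
          rw [abs_mul]
          exact mul_le_mul_of_nonneg_left (hterm j) (abs_nonneg _)
      _ = ν * lev * ∑ j ∈ S, |u j| := by rw [← Finset.sum_mul, mul_comm]
      _ ≤ _ := by gcongr
  -- The gradient error is not supported on `S`, but only its pairing with `u` matters, and `u` is;
  -- so the restricted isometry suffices.
  have hsplit : ‖u‖ * ‖u‖ = inner ℝ (h - ν • g0) u - ν * inner ℝ (G - g0) u +
      inner ℝ (u - (h - ν • G)) u := by
    rw [← real_inner_self_eq_norm_mul_norm]
    simp only [inner_sub_left, inner_smul_left]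
    simp
    ring
  have hle : ‖u‖ * ‖u‖ ≤ ((1 - ν) * ‖h‖ + ν * (4 * ‖h‖ ^ 2) + ν * (1 / 40 * ‖h‖) +
      ν * (1 / 20 * ‖h‖)) * ‖u‖ := by
    have t1 : inner ℝ (h - ν • g0) u ≤ ((1 - ν) * ‖h‖ + ν * (4 * ‖h‖ ^ 2)) * ‖u‖ :=
      (real_inner_le_norm _ _).trans (by gcongr)
    have t2 : -(ν * inner ℝ (G - g0) u) ≤ ν * (1 / 40 * ‖h‖ * ‖u‖) := by
      have := mul_le_mul_of_nonneg_left (abs_le.1 hgrad).1 hν0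
      linarith
    have t3 : inner ℝ (u - (h - ν • G)) u ≤ ν * (1 / 20 * ‖h‖) * ‖u‖ := by
      refine (le_abs_self _).trans (hthr.trans ?_)
      calc _ = ν * (√S.card * lev) * ‖u‖ := by ring
        _ ≤ _ := by gcongr
    rw [hsplit]
    linarith
  have hun : ‖u‖ ≤ (1 - ν) * ‖h‖ + ν * (4 * ‖h‖ ^ 2) + ν * (1 / 40 * ‖h‖) +
      ν * (1 / 20 * ‖h‖) := by
    rcases (norm_nonneg u).eq_or_lt with h0 | h0
    · rw [← h0]
      have := norm_nonneg h
      have : 0 ≤ 1 - ν := by linarith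
      positivity
    · exact le_of_mul_le_mul_right hle h0
  refine hun.trans ?_
  have hh0 := norm_nonneg h
  -- The relative errors `1/5 + 1/40 + 1/20` total less than `1/2`, leaving a decrease of at least
  -- `ν/2 ≥ μ/4`, more than the required `μ/16`.
  have hsq : 4 * ‖h‖ ^ 2 ≤ 1 / 5 * ‖h‖ := by nlinarith
  have : ν * (4 * ‖h‖ ^ 2) ≤ ν * (1 / 5 * ‖h‖) := by gcongr
  have h5 : μ / 2 * ‖h‖ ≤ ν * ‖h‖ := by gcongr
  have h6 : 0 ≤ ν * ‖h‖ := by positivity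
  nlinarith

end Contraction

/-! ### Spectral initialization: leading eigenvectors near `x xᵀ` and power iteration -/

section Spectral

variable {n m : ℕ}

/-- `M` is within `η` of `x xᵀ` in operator norm. -/
def NearRankOne (M : Matrix (Fin n) (Fin n) ℝ) (x : EuclideanSpace ℝ (Fin n)) (η : ℝ) : Prop :=
  ∀ w w' : EuclideanSpace ℝ (Fin n),
    |inner ℝ w (WithLp.toLp 2 (M *ᵥ w'.ofLp)) - inner ℝ x w * inner ℝ x w'| ≤ η * (‖w‖ * ‖w'‖)

lemma inner_mulVec_comm {M : Matrix (Fin n) (Fin n) ℝ} (hM : Mᵀ = M)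
    (w w' : EuclideanSpace ℝ (Fin n)) :
    inner ℝ w (WithLp.toLp 2 (M *ᵥ w'.ofLp)) = inner ℝ (WithLp.toLp 2 (M *ᵥ w.ofLp)) w' := by
  rw [EuclideanSpace.inner_eq_star_dotProduct, EuclideanSpace.inner_eq_star_dotProduct]
  simp only [star_trivial]
  rw [dotProduct_comm, Matrix.dotProduct_mulVec, ← Matrix.mulVec_transpose, hM, dotProduct_comm]

/-- The Rayleigh quotient at `x` is at least `1 - η`, and for a symmetric matrix the supremum of the
quotient is an eigenvalue. -/
lemma le_leading_eigenvalue {M : Matrix (Fin n) (Fin n) ℝ} {x : EuclideanSpace ℝ (Fin n)} {η ev : ℝ}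
    (hM : Mᵀ = M) (hx : ‖x‖ = 1) (hη : NearRankOne M x η)
    (hev : ∀ (ν : ℝ) (w : Fin n → ℝ), w ≠ 0 → M *ᵥ w = ν • w → ν ≤ ev) :
    1 - η ≤ ev := by
  have hx0 : x ≠ 0 := by
    rintro rfl
    simp at hx
  have : Nontrivial (EuclideanSpace ℝ (Fin n)) := ⟨⟨x, 0, hx0⟩⟩
  let T : EuclideanSpace ℝ (Fin n) →ₗ[ℝ] EuclideanSpace ℝ (Fin n) :=
    { toFun := fun w => WithLp.toLp 2 (M *ᵥ w.ofLp)
      map_add' := fun w w' => by simp [Matrix.mulVec_add]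
      map_smul' := fun r w => by simp [Matrix.mulVec_smul] }
  have hT : T.IsSymmetric := fun w w' => (inner_mulVec_comm hM w w').symm
  have heig := hT.hasEigenvalue_iSup_of_finiteDimensional
  set lam : ℝ := ⨆ y : { y : EuclideanSpace ℝ (Fin n) // y ≠ 0 },
    RCLike.re (inner ℝ (T ↑y) ↑y : ℝ) / ‖(y : EuclideanSpace ℝ (Fin n))‖ ^ 2 with hlam
  obtain ⟨w, hw⟩ := heig.exists_hasEigenvector
  have h1 : lam ≤ ev := by
    refine hev lam w.ofLp (fun h => hw.2 (by ext j; simp [h])) ?_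
    have := congrArg WithLp.ofLp hw.apply_eq_smul
    simpa [T] using this
  refine le_trans ?_ h1
  -- A real supremum over an unbounded range has the default value `0`, so boundedness must be shown
  -- before comparing with the value at `x`.
  have hb : BddAbove (Set.range fun y : { y : EuclideanSpace ℝ (Fin n) // y ≠ 0 } =>
      RCLike.re (inner ℝ (T ↑y) ↑y : ℝ) / ‖(y : EuclideanSpace ℝ (Fin n))‖ ^ 2) := by
    refine ⟨1 + η, ?_⟩
    rintro _ ⟨y, rfl⟩
    have hy : 0 < ‖(y : EuclideanSpace ℝ (Fin n))‖ := norm_pos_iff.2 y.2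
    have h2 := (abs_le.1 (hη y y)).2
    have h3 := abs_le.1 ((abs_real_inner_le_norm x y).trans (by rw [hx, one_mul]))
    simp only
    rw [div_le_iff₀ (by positivity)]
    have h4 : RCLike.re (inner ℝ (T ↑y) ↑y : ℝ) =
      inner ℝ (y : EuclideanSpace ℝ (Fin n)) (WithLp.toLp 2 (M *ᵥ (y : EuclideanSpace ℝ (Fin n)).ofLp)) := by
      rw [inner_mulVec_comm hM]
      rfl
    rw [h4]
    nlinarith [h3.1, h3.2]
  have h5 := le_ciSup hb ⟨x, hx0⟩
  refine le_trans ?_ h5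
  have h6 := (abs_le.1 (hη x x)).1
  rw [real_inner_self_eq_norm_sq, hx, real_inner_comm] at h6
  simp only [hx]
  have h7 : RCLike.re (inner ℝ (T x) x : ℝ) = inner ℝ (WithLp.toLp 2 (M *ᵥ x.ofLp)) x := rfl
  rw [h7]
  norm_num at h6 ⊢
  linarith

/-- Power iteration started at `x`. -/
def powerIter (M : Matrix (Fin n) (Fin n) ℝ) (x : EuclideanSpace ℝ (Fin n)) :
    ℕ → EuclideanSpace ℝ (Fin n)
  | 0 => x
  | k + 1 => WithLp.toLp 2 (M *ᵥ (powerIter M x k).ofLp)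

/-- The coordinatewise limit of normalized power iteration. -/
def powerLimit (M : Matrix (Fin n) (Fin n) ℝ) (x : EuclideanSpace ℝ (Fin n)) :
    EuclideanSpace ℝ (Fin n) :=
  WithLp.toLp 2 fun j =>
    Filter.limsup (fun k => ‖powerIter M x k‖⁻¹ * powerIter M x k j) Filter.atTop

/-- Pair `M w` with itself: the rank-one part and the perturbation each contribute at most a
quarter. -/
lemma norm_mulVec_le_half {M : Matrix (Fin n) (Fin n) ℝ} {x w : EuclideanSpace ℝ (Fin n)} {η : ℝ}
    (hη : NearRankOne M x η) (hη4 : η ≤ 1 / 4) (hx : ‖x‖ = 1)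
    (hw : |inner ℝ x w| ≤ 1 / 4 * ‖w‖) : ‖WithLp.toLp 2 (M *ᵥ w.ofLp)‖ ≤ 1 / 2 * ‖w‖ := by
  set u : EuclideanSpace ℝ (Fin n) := WithLp.toLp 2 (M *ᵥ w.ofLp) with hu
  have h1 := (abs_le.1 (hη u w)).2
  rw [← hu, real_inner_self_eq_norm_mul_norm] at h1
  have h2 : inner ℝ x u * inner ℝ x w ≤ ‖u‖ * (1 / 4 * ‖w‖) := by
    refine (le_abs_self _).trans ?_
    rw [abs_mul]
    have := abs_real_inner_le_norm x u
    rw [hx, one_mul] at this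
    gcongr
  have h3 : η * (‖u‖ * ‖w‖) ≤ 1 / 4 * (‖u‖ * ‖w‖) := by gcongr
  rcases (norm_nonneg u).eq_or_lt with h0 | h0
  · rw [← h0]
    positivity
  · refine le_of_mul_le_mul_left ?_ h0
    linarith

/-- The eigenvalue `vᵀ M v` is at least `1 - η` and at most `⟪x, v⟫² + η`. -/
lemma leading_eigenvector_overlap {M : Matrix (Fin n) (Fin n) ℝ} {x v : EuclideanSpace ℝ (Fin n)}
    {η : ℝ} (hM : Mᵀ = M) (hx : ‖x‖ = 1) (hη : NearRankOne M x η)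
    (hv : IsLeadingEigenvector M v) : 1 - 2 * η ≤ inner ℝ v x ^ 2 := by
  obtain ⟨hv1, ev, hev, hmax⟩ := hv
  have h1 := le_leading_eigenvalue hM hx hη hmax
  have h2 := (abs_le.1 (hη v v)).2
  rw [hev, WithLp.toLp_smul, WithLp.toLp_ofLp, inner_smul_right, real_inner_self_eq_norm_sq, hv1,
    real_inner_comm] at h2
  nlinarith

/-- The component along `v` is multiplied by `ev ≥ 31/32` at each step, while the orthogonal
component is at least halved. The limit is `v` up to sign, whichever leading eigenvector `v` was
chosen. -/
lemma tendsto_powerIter {M : Matrix (Fin n) (Fin n) ℝ} {x v : EuclideanSpace ℝ (Fin n)} {η : ℝ}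
    (hM : Mᵀ = M) (hx : ‖x‖ = 1) (hη : NearRankOne M x η) (hη32 : η ≤ 1 / 32)
    (hv : IsLeadingEigenvector M v) :
    Filter.Tendsto (fun k => ‖powerIter M x k‖⁻¹ • powerIter M x k) Filter.atTop
      (nhds ((|inner ℝ v x|⁻¹ * inner ℝ v x) • v)) := by
  have hover := leading_eigenvector_overlap hM hx hη hv
  obtain ⟨hv1, ev, hev, hmax⟩ := hv
  have hev1 := le_leading_eigenvalue hM hx hη hmax
  set s := inner ℝ v x with hs
  have hs0 : s ≠ 0 := by
    intro h
    rw [h] at hover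
    norm_num at hover
    linarith
  have hevpos : 0 < ev := by linarith
  have hperp : ∀ k, inner ℝ v (powerIter M x k - (ev ^ k * s) • v) = 0 ∧
      ‖powerIter M x k - (ev ^ k * s) • v‖ ≤ (1 / 2) ^ k := by
    -- For `w ⟂ v` only `x - s v` is seen, and `‖x - s v‖² = 1 - s² ≤ 2η ≤ 1/16`.
    have hsmall : ∀ w : EuclideanSpace ℝ (Fin n), inner ℝ v w = 0 →
        |inner ℝ x w| ≤ 1 / 4 * ‖w‖ := by
      intro w hw
      have e : inner ℝ x w = inner ℝ (x - s • v) w := by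
        rw [inner_sub_left, inner_smul_left, hw, mul_zero, sub_zero]
      have hn : ‖x - s • v‖ ≤ 1 / 4 := by
        refine le_of_sq_le_sq ?_ (by norm_num)
        rw [norm_sub_sq_real, norm_smul, inner_smul_right, real_inner_comm, ← hs, hx, hv1, mul_one,
          Real.norm_eq_abs, sq_abs]
        nlinarith
      rw [e]
      exact (abs_real_inner_le_norm _ _).trans (by gcongr)
    intro k
    induction k with
    | zero =>
      have h0 : inner ℝ v (x - s • v) = 0 := by
        rw [inner_sub_right, inner_smul_right, real_inner_self_eq_norm_sq, hv1, ← hs]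
        ring
      simp only [powerIter, pow_zero, one_mul]
      refine ⟨h0, ?_⟩
      refine le_of_sq_le_sq ?_ (by norm_num)
      rw [norm_sub_sq_real, norm_smul, inner_smul_right, real_inner_comm, ← hs, hx, hv1, mul_one,
        Real.norm_eq_abs, sq_abs]
      nlinarith [sq_nonneg s]
    | succ k ih =>
      have e : powerIter M x (k + 1) - (ev ^ (k + 1) * s) • v =
          WithLp.toLp 2 (M *ᵥ (powerIter M x k - (ev ^ k * s) • v).ofLp) := by
        rw [WithLp.ofLp_sub, WithLp.ofLp_smul, Matrix.mulVec_sub, Matrix.mulVec_smul, hev,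
          WithLp.toLp_sub, WithLp.toLp_smul, WithLp.toLp_smul, WithLp.toLp_ofLp, smul_smul]
        congr 2
        ring
      rw [e]
      constructor
      · rw [inner_mulVec_comm hM, hev, WithLp.toLp_smul, WithLp.toLp_ofLp, inner_smul_left, ih.1,
          mul_zero]
      · refine (norm_mulVec_le_half hη (by linarith) hx (hsmall _ ih.1)).trans ?_
        rw [pow_succ]
        linarith [ih.2]
  have hlim : Filter.Tendsto (fun k => (ev ^ k)⁻¹ • powerIter M x k) Filter.atTop
      (nhds (s • v)) := by
    rw [tendsto_iff_norm_sub_tendsto_zero]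
    refine squeeze_zero (g := fun k => (1 / 2 / ev) ^ k) (fun k => norm_nonneg _) (fun k => ?_) ?_
    · have e : (ev ^ k)⁻¹ • powerIter M x k - s • v =
          (ev ^ k)⁻¹ • (powerIter M x k - (ev ^ k * s) • v) := by
        rw [smul_sub, smul_smul, inv_mul_cancel_left₀ (by positivity)]
      rw [e, norm_smul, norm_inv, norm_pow, Real.norm_eq_abs, abs_of_pos hevpos, div_pow,
        div_eq_inv_mul]
      exact mul_le_mul_of_nonneg_left (hperp k).2 (by positivity)
    · refine tendsto_pow_atTop_nhds_zero_of_lt_one (by positivity) ?_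
      rw [div_lt_one hevpos]
      linarith
  have hnorm := hlim.norm
  have hns : ‖s • v‖ = |s| := by rw [norm_smul, hv1, mul_one, Real.norm_eq_abs]
  rw [hns] at hnorm
  have hres := (hnorm.inv₀ (abs_ne_zero.2 hs0)).smul hlim
  rw [smul_smul] at hres
  refine hres.congr fun k => ?_
  have hk : 0 < ev ^ k := by positivity
  rw [norm_smul, smul_smul, norm_inv, Real.norm_eq_abs, abs_of_pos hk]
  congr 1
  field_simp

lemma powerLimit_eq {M : Matrix (Fin n) (Fin n) ℝ} {x v : EuclideanSpace ℝ (Fin n)} {η : ℝ}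
    (hM : Mᵀ = M) (hx : ‖x‖ = 1) (hη : NearRankOne M x η) (hη32 : η ≤ 1 / 32)
    (hv : IsLeadingEigenvector M v) :
    powerLimit M x = (|inner ℝ v x|⁻¹ * inner ℝ v x) • v := by
  have h := tendsto_powerIter hM hx hη hη32 hv
  ext j
  have hj := ((EuclideanSpace.proj (𝕜 := ℝ) j).continuous.tendsto _).comp h
  exact Filter.Tendsto.limsup_eq hj

/-- Some signed leading eigenvector is close to the signal. -/
lemma norm_sign_smul_sub_le {x v : EuclideanSpace ℝ (Fin n)} {η : ℝ} (hx : ‖x‖ = 1)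
    (hv : ‖v‖ = 1) (hover : 1 - 2 * η ≤ inner ℝ v x ^ 2) (hη : η ≤ 1 / 10000) :
    ∃ σ : ℝ, (σ = 1 ∨ σ = -1) ∧ ‖v - σ • x‖ ≤ 1 / 50 := by
  have habs := abs_real_inner_le_norm v x
  rw [hv, hx, one_mul] at habs
  have hkey : ∀ σ : ℝ, σ ^ 2 = 1 → σ * inner ℝ v x = |inner ℝ v x| → ‖v - σ • x‖ ≤ 1 / 50 := by
    intro σ hσ hσ2
    refine le_of_sq_le_sq ?_ (by norm_num)
    rw [norm_sub_sq_real, norm_smul, inner_smul_right, hσ2, hx, hv, mul_one, Real.norm_eq_abs,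
      sq_abs, hσ]
    rw [← sq_abs] at hover
    nlinarith [abs_nonneg (inner ℝ v x : ℝ)]
  rcases le_total 0 (inner ℝ v x : ℝ) with h | h
  · exact ⟨1, Or.inl rfl, hkey 1 (by norm_num) (by rw [abs_of_nonneg h, one_mul])⟩
  · exact ⟨-1, Or.inr rfl, hkey (-1) (by norm_num) (by rw [abs_of_nonpos h]; ring)⟩

/-- The restricted data matrix is close to `x xᵀ` when the estimated support captures most of
the signal. -/
lemma nearRankOne_restrict {a : Fin m × Fin n × Fin n → ℝ} {x : EuclideanSpace ℝ (Fin n)}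
    {S S₀ : Finset (Fin n)} {δ ε : ℝ} (hrip : IsRIP a (S ×ˢ S) δ) (hδ : 0 ≤ δ) (hx : ‖x‖ = 1)
    (hxS : SupportedOn S x) (hS₀ : S₀ ⊆ S) (hε : ‖x - coordProj S₀ x‖ ≤ ε) :
    NearRankOne (restrict S₀ (symPart (dataMatrix (arr a) (obs a x)))) x (δ + 2 * ε) := by
  intro w w'
  rw [inner_restrict_mulVec, inner_symPart_dataMatrix_mulVec]
  have h1 := hrip _ _ (supportedOn_tensor hxS hxS) (supportedOn_symTensor
    (supportedOn_coordProj hS₀ w) (supportedOn_coordProj hS₀ w'))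
  rw [inner_tensor_self_symTensor, inner_coordProj, inner_coordProj, norm_tensor, hx, one_mul,
    one_mul] at h1
  have h2 : δ * ‖symTensor (coordProj S₀ w) (coordProj S₀ w')‖ ≤ δ * (‖w‖ * ‖w'‖) := by
    gcongr
    refine (norm_symTensor_le _ _).trans ?_
    gcongr <;> exact norm_coordProj_le _ _
  set u := coordProj S₀ x with hu
  have hu1 : ‖u‖ ≤ 1 := hx ▸ norm_coordProj_le S₀ x
  have hε0 : 0 ≤ ε := (norm_nonneg _).trans hε
  have h3 : |inner ℝ u w * inner ℝ u w' - inner ℝ x w * inner ℝ x w'| ≤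
      2 * ε * (‖w‖ * ‖w'‖) := by
    have e : inner ℝ u w * inner ℝ u w' - inner ℝ x w * inner ℝ x w' =
        -(inner ℝ (x - u) w * inner ℝ u w') - inner ℝ x w * inner ℝ (x - u) w' := by
      rw [inner_sub_left, inner_sub_left]
      ring
    rw [e]
    refine (abs_sub _ _).trans ?_
    rw [abs_neg, abs_mul, abs_mul]
    have b1 : |inner ℝ (x - u) w| ≤ ε * ‖w‖ :=
      (abs_real_inner_le_norm _ _).trans (by gcongr)
    have b2 : |inner ℝ (x - u) w'| ≤ ε * ‖w'‖ :=
      (abs_real_inner_le_norm _ _).trans (by gcongr)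
    have b3 : |inner ℝ u w'| ≤ 1 * ‖w'‖ :=
      (abs_real_inner_le_norm _ _).trans (by gcongr)
    have b4 : |inner ℝ x w| ≤ 1 * ‖w‖ := by
      rw [← hx]; exact abs_real_inner_le_norm _ _
    calc _ ≤ (ε * ‖w‖) * (1 * ‖w'‖) + (1 * ‖w‖) * (ε * ‖w'‖) := by gcongr
      _ = _ := by ring
  calc _ ≤ |gram a (tensor x x) (symTensor (coordProj S₀ w) (coordProj S₀ w')) -
          inner ℝ u w * inner ℝ u w'| +
        |inner ℝ u w * inner ℝ u w' - inner ℝ x w * inner ℝ x w'| := abs_sub_le _ _ _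
    _ ≤ _ := by linarith

end Spectral

/-! ### Measurable candidate iterates and masking of the data -/

section Candidate

variable {n m : ℕ}

/-- The signed output of the spectral initialization, computed by power iteration from `x`. -/
def initCandidate (α σ : ℝ) (x : EuclideanSpace ℝ (Fin n)) (a : Fin m × Fin n × Fin n → ℝ) :
    EuclideanSpace ℝ (Fin n) :=
  (phi (obs a x) * σ) • powerLimit (restrict (suppEst α (arr a) (obs a x))
    (symPart (dataMatrix (arr a) (obs a x)))) x

/-- The iterates of the algorithm started at `initCandidate`. -/
def candidate (𝒯 : ℝ → ℝ → ℝ) (α β μ σ : ℝ) (x : EuclideanSpace ℝ (Fin n))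
    (a : Fin m × Fin n × Fin n → ℝ) : ℕ → EuclideanSpace ℝ (Fin n)
  | 0 => initCandidate α σ x a
  | t + 1 => update 𝒯 β μ (arr a) (obs a x) (candidate 𝒯 α β μ σ x a t)

section Measurability

variable {x : EuclideanSpace ℝ (Fin n)}

lemma measurable_norm_of_coord {X : Type*} [MeasurableSpace X] {z : X → EuclideanSpace ℝ (Fin n)}
    (hz : ∀ j, Measurable fun a => z a j) : Measurable fun a => ‖z a‖ := by
  simp only [EuclideanSpace.norm_eq]
  exact (Finset.measurable_fun_sum _ fun j _ => ((hz j).norm.pow_const 2)).sqrt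

lemma measurable_quad_arr {z : (Fin m × Fin n × Fin n → ℝ) → EuclideanSpace ℝ (Fin n)}
    (hz : ∀ j, Measurable fun a => z a j) (i : Fin m) :
    Measurable fun a : Fin m × Fin n × Fin n → ℝ => quad (arr a i) (z a) := by
  simp only [quad_arr, inner_row, tensor_apply]
  exact Finset.measurable_fun_sum _ fun p _ =>
    ((hz p.1).mul (hz p.2)).mul (measurable_pi_apply _)

lemma measurable_obs (x : EuclideanSpace ℝ (Fin n)) (i : Fin m) :
    Measurable fun a : Fin m × Fin n × Fin n → ℝ => obs a x i :=
  measurable_quad_arr (z := fun _ => x) (fun _ => measurable_const) i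

lemma measurable_phi_obs (x : EuclideanSpace ℝ (Fin n)) :
    Measurable fun a : Fin m × Fin n × Fin n → ℝ => phi (obs a x) := by
  have h := fun i => measurable_obs (m := m) x i
  unfold phi
  fun_prop

lemma measurable_symPart_arr (i : Fin m) (j l : Fin n) :
    Measurable fun a : Fin m × Fin n × Fin n → ℝ => symPart (arr a i) j l := by
  simp only [symPart, Matrix.smul_apply, Matrix.add_apply, Matrix.transpose_apply, arr_apply,
    smul_eq_mul]
  fun_prop

lemma measurable_grad_arr {z : (Fin m × Fin n × Fin n → ℝ) → EuclideanSpace ℝ (Fin n)}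
    (hz : ∀ j, Measurable fun a => z a j) (j : Fin n) :
    Measurable fun a : Fin m × Fin n × Fin n → ℝ => grad (arr a) (obs a x) (z a) j := by
  have h1 := fun i => measurable_obs (m := m) x i
  have h2 := fun i => measurable_quad_arr (m := m) hz i
  have h3 := fun i j l => measurable_symPart_arr (m := m) (n := n) i j l
  simp only [grad, PiLp.smul_apply, WithLp.ofLp_sum, Finset.sum_apply, smul_eq_mul,
    Matrix.mulVec, dotProduct]
  exact (Finset.measurable_fun_sum _ fun i _ => ((h2 i).sub (h1 i)).mul
    (Finset.measurable_fun_sum _ fun l _ => (h3 i j l).mul (hz l))).const_mul _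

lemma measurable_level_arr {β : ℝ}
    {z : (Fin m × Fin n × Fin n → ℝ) → EuclideanSpace ℝ (Fin n)}
    (hz : ∀ j, Measurable fun a => z a j) :
    Measurable fun a : Fin m × Fin n × Fin n → ℝ => level β (arr a) (obs a x) (z a) := by
  have h1 := fun i => measurable_obs (m := m) x i
  have h2 := fun i => measurable_quad_arr (m := m) hz i
  simp only [level]
  exact ((Finset.measurable_fun_sum _ fun i _ => ((h2 i).sub (h1 i)).pow_const 2).const_mul
    _).sqrt.mul (measurable_norm_of_coord hz)

lemma measurable_update_arr {𝒯 : ℝ → ℝ → ℝ} (h𝒯 : Measurable (Function.uncurry 𝒯)) {β μ : ℝ}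
    {z : (Fin m × Fin n × Fin n → ℝ) → EuclideanSpace ℝ (Fin n)}
    (hz : ∀ j, Measurable fun a => z a j) (j : Fin n) :
    Measurable fun a : Fin m × Fin n × Fin n → ℝ =>
      update 𝒯 β μ (arr a) (obs a x) (z a) j := by
  have h1 := measurable_phi_obs (m := m) x
  have h2 := measurable_level_arr (m := m) (x := x) (β := β) hz
  have h3 := measurable_grad_arr (m := m) (x := x) hz j
  have h4 := hz j
  have h5 := (h1.pow_const 2).const_div μ
  exact h𝒯.comp ((h5.mul h2).prodMk (h4.sub (h5.mul h3)))

lemma measurableSet_mem_suppEst (α : ℝ) (j : Fin n) :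
    MeasurableSet {a : Fin m × Fin n × Fin n → ℝ | j ∈ suppEst α (arr a) (obs a x)} := by
  have h1 := fun i => measurable_obs (m := m) x i
  have h2 := measurable_phi_obs (m := m) x
  have e : {a : Fin m × Fin n × Fin n → ℝ | j ∈ suppEst α (arr a) (obs a x)} =
      {a | α * phi (obs a x) ^ 2 * √(Real.log n / m) < diagStat (arr a) (obs a x) j} := by
    ext a
    simp [suppEst]
  rw [e]
  refine measurableSet_lt (by fun_prop) ?_
  simp only [diagStat, arr_apply]
  fun_prop

lemma measurable_restrict_dataMatrix (α : ℝ) (j l : Fin n) :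
    Measurable fun a : Fin m × Fin n × Fin n → ℝ =>
      restrict (suppEst α (arr a) (obs a x)) (symPart (dataMatrix (arr a) (obs a x))) j l := by
  have h1 := fun i => measurable_obs (m := m) x i
  simp only [restrict, Matrix.of_apply]
  refine Measurable.ite ((measurableSet_mem_suppEst α j).inter (measurableSet_mem_suppEst α l)) ?_
    measurable_const
  simp only [symPart, dataMatrix, Matrix.smul_apply, Matrix.add_apply, Matrix.transpose_apply,
    Matrix.sum_apply, arr_apply, smul_eq_mul]
  fun_prop

lemma measurable_powerLimit {X : Type*} [MeasurableSpace X] {M : X → Matrix (Fin n) (Fin n) ℝ}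
    (hM : ∀ j l, Measurable fun a => M a j l) (x : EuclideanSpace ℝ (Fin n)) (j : Fin n) :
    Measurable fun a => powerLimit (M a) x j := by
  have h1 : ∀ k j, Measurable fun a => powerIter (M a) x k j := by
    intro k
    induction k with
    | zero =>
      intro j
      simp only [powerIter]
      exact measurable_const
    | succ k ih =>
      intro j
      simp only [powerIter, Matrix.mulVec, dotProduct]
      exact Finset.measurable_fun_sum _ fun l _ => (hM j l).mul (ih l)
  exact Measurable.limsup fun k => (measurable_norm_of_coord (h1 k)).inv.mul (h1 k j)

/-- The conditional Gaussian bound needs measurable coefficients. This is why the candidate starts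
from a limsup of power iterates instead of a chosen eigenvector. -/
lemma measurable_candidate {𝒯 : ℝ → ℝ → ℝ} (h𝒯 : Measurable (Function.uncurry 𝒯))
    (α β μ σ : ℝ) (x : EuclideanSpace ℝ (Fin n)) (t : ℕ) (j : Fin n) :
    Measurable fun a : Fin m × Fin n × Fin n → ℝ => candidate 𝒯 α β μ σ x a t j := by
  induction t generalizing j with
  | zero =>
    have h1 := measurable_phi_obs (m := m) x
    have h2 := measurable_powerLimit (fun j l => measurable_restrict_dataMatrix (m := m)
      (x := x) α j l) x j
    simp only [candidate, initCandidate, PiLp.smul_apply, smul_eq_mul]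
    exact (h1.mul_const σ).mul h2
  | succ t ih => exact measurable_update_arr h𝒯 ih j

end Measurability

/-- Set the entries of all measurement matrices outside `S × S` to zero. -/
def mask (S : Finset (Fin n)) (a : Fin m × Fin n × Fin n → ℝ) : Fin m × Fin n × Fin n → ℝ :=
  fun p => if p.2 ∈ S ×ˢ S then a p else 0

variable {S : Finset (Fin n)}

lemma measurable_mask : Measurable (mask (m := m) S) := by
  refine measurable_pi_lambda _ fun p => ?_
  by_cases h : p.2 ∈ S ×ˢ S <;> simp only [mask, h, if_true, if_false] <;> fun_prop

lemma inner_row_mask (a : Fin m × Fin n × Fin n → ℝ) (i : Fin m)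
    {M : EuclideanSpace ℝ (Fin n × Fin n)} (hM : SupportedOn (S ×ˢ S) M) :
    inner ℝ (row (mask S a) i) M = inner ℝ (row a i) M := by
  rw [inner_row, inner_row]
  refine Finset.sum_congr rfl fun p _ => ?_
  by_cases h : p ∈ S ×ˢ S
  · simp only [mask, if_pos h]
  · simp [hM p h]

lemma gram_mask (a : Fin m × Fin n × Fin n → ℝ) {M N : EuclideanSpace ℝ (Fin n × Fin n)}
    (hM : SupportedOn (S ×ˢ S) M) (hN : SupportedOn (S ×ˢ S) N) :
    gram (mask S a) M N = gram a M N := by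
  simp only [gram, inner_row_mask a _ hM, inner_row_mask a _ hN]

lemma obs_mask (a : Fin m × Fin n × Fin n → ℝ) {x : EuclideanSpace ℝ (Fin n)}
    (hx : SupportedOn S x) : obs (mask S a) x = obs a x := by
  funext i
  simp only [obs, quad_arr, inner_row_mask a i (supportedOn_tensor hx hx)]

lemma quad_mask (a : Fin m × Fin n × Fin n → ℝ) (i : Fin m) {z : EuclideanSpace ℝ (Fin n)}
    (hz : SupportedOn S z) : quad (arr (mask S a) i) z = quad (arr a i) z := by
  simp only [quad_arr, inner_row_mask a i (supportedOn_tensor hz hz)]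

/-- Off-support statistics are conditionally Gaussian given the data on `S × S`. -/
lemma offSupport_tail (S : Finset (Fin n)) (r : (Fin m × Fin n × Fin n → ℝ) → Fin m → ℝ)
    (N : (Fin m × Fin n × Fin n → ℝ) → EuclideanSpace ℝ (Fin n × Fin n))
    (hr : ∀ i, Measurable fun a => r a i) (hN : ∀ p, Measurable fun a => N a p)
    (hN0 : ∀ a, ∀ p ∈ S ×ˢ S, N (mask S a) p = 0) {s : ℝ} (hs : 0 ≤ s) :
    (gaussianPi (Fin m × Fin n × Fin n)).real
      {a | s * (√(1 / (m : ℝ) ^ 2 * ∑ i, r (mask S a) i ^ 2) * ‖N (mask S a)‖) <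
        |(1 / (m : ℝ)) * ∑ i, r (mask S a) i * inner ℝ (row a i) (N (mask S a))|} ≤
      2 * Real.exp (-s ^ 2 / 2) := by
  classical
  -- Evaluated on masked data, the coefficients depend only on the `S × S` entries, and they vanish
  -- there by `hN0`: exactly the setting of `gaussianPi_conditional_tail`.
  let c : (Fin m × Fin n × Fin n → ℝ) → Fin m × Fin n × Fin n → ℝ := fun a p =>
    1 / (m : ℝ) * r (mask S a) p.1 * N (mask S a) p.2
  have hc : Measurable c := by
    refine measurable_pi_lambda _ fun p => ?_
    have h1 := (hr p.1).comp (measurable_mask (m := m) (S := S))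
    have h2 := (hN p.2).comp (measurable_mask (m := m) (S := S))
    exact (h1.const_mul _).mul h2
  have hA : ∀ a, √(∑ p, c a p ^ 2) =
      √(1 / (m : ℝ) ^ 2 * ∑ i, r (mask S a) i ^ 2) * ‖N (mask S a)‖ := by
    intro a
    rw [Fintype.sum_prod_type, EuclideanSpace.norm_eq, ← Real.sqrt_mul (by positivity)]
    congr 1
    rw [mul_assoc, Finset.sum_mul, Finset.mul_sum]
    refine Finset.sum_congr rfl fun i _ => ?_
    rw [Finset.mul_sum, Finset.mul_sum]
    refine Finset.sum_congr rfl fun p _ => ?_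
    simp only [c, Real.norm_eq_abs, sq_abs]
    ring
  have hB : ∀ a, ∑ p, c a p * a p =
      (1 / (m : ℝ)) * ∑ i, r (mask S a) i * inner ℝ (row a i) (N (mask S a)) := by
    intro a
    rw [Fintype.sum_prod_type, Finset.mul_sum]
    refine Finset.sum_congr rfl fun i _ => ?_
    rw [inner_row, Finset.mul_sum, Finset.mul_sum]
    refine Finset.sum_congr rfl fun p _ => ?_
    simp only [c]
    ring
  have h := gaussianPi_conditional_tail {p : Fin m × Fin n × Fin n | p.2 ∈ S ×ˢ S} c hc
    (fun a b hab => ?_) (fun a p hp => ?_) hs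
  · simpa only [hA, hB] using h
  · have : mask S a = mask S b := by
      funext p
      by_cases hp : p.2 ∈ S ×ˢ S
      · simp only [mask, if_pos hp, hab p hp]
      · simp only [mask, if_neg hp]
    simp only [c, this]
  · have := hN0 a p.2 hp
    simp only [c, this, mul_zero]

end Candidate

/-! ### The true run coincides with the masked run on good data -/

section Tracking

variable {n m : ℕ} {S : Finset (Fin n)} {x : EuclideanSpace ℝ (Fin n)}

lemma inner_row_mask_eq_zero (a : Fin m × Fin n × Fin n → ℝ) (i : Fin m)
    {N : EuclideanSpace ℝ (Fin n × Fin n)} (hN : ∀ p ∈ S ×ˢ S, N p = 0) :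
    inner ℝ (row (mask S a) i) N = 0 := by
  rw [inner_row]
  refine Finset.sum_eq_zero fun p _ => ?_
  by_cases h : p ∈ S ×ˢ S
  · rw [hN p h, zero_mul]
  · simp only [mask, if_neg h, mul_zero]

/-- The tensor lives on row `j` and column `j`, both disjoint from `S × S`. Hence an off-support
gradient coordinate meets only entries that the masked run has not seen. -/
lemma symTensor_single_eq_zero {j : Fin n} (hj : j ∉ S) (z : EuclideanSpace ℝ (Fin n)) :
    ∀ p ∈ S ×ˢ S, symTensor (EuclideanSpace.single j 1) z p = 0 := by
  intro p hp
  obtain ⟨h1, h2⟩ := Finset.mem_product.1 hp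
  have e1 : p.1 ≠ j := fun h => hj (h ▸ h1)
  have e2 : p.2 ≠ j := fun h => hj (h ▸ h2)
  simp [symTensor, e1, e2]

lemma tensor_single_eq_zero {j : Fin n} (hj : j ∉ S) :
    ∀ p ∈ S ×ˢ S, tensor (EuclideanSpace.single j 1) (EuclideanSpace.single j 1) p = 0 := by
  intro p hp
  obtain ⟨h1, -⟩ := Finset.mem_product.1 hp
  have e1 : p.1 ≠ j := fun h => hj (h ▸ h1)
  simp [e1]

lemma supportedOn_single {l : Fin n} (hl : l ∈ S) :
    SupportedOn S (EuclideanSpace.single l (1 : ℝ)) := by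
  intro j hj
  have : j ≠ l := fun h => hj (h ▸ hl)
  simp [this]

lemma grad_apply (a : Fin m × Fin n × Fin n → ℝ) (x z : EuclideanSpace ℝ (Fin n)) (j : Fin n) :
    grad (arr a) (obs a x) z j =
      gram a (tensor z z - tensor x x) (symTensor (EuclideanSpace.single j 1) z) := by
  rw [← inner_grad, EuclideanSpace.inner_single_right]
  simp

lemma level_mask (β : ℝ) (a : Fin m × Fin n × Fin n → ℝ) {z : EuclideanSpace ℝ (Fin n)}
    (hx : SupportedOn S x) (hz : SupportedOn S z) :
    level β (arr (mask S a)) (obs (mask S a) x) z = level β (arr a) (obs a x) z := by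
  simp only [level, obs_mask a hx, quad_mask a _ hz]

lemma level_nonneg {A : Fin m → Matrix (Fin n) (Fin n) ℝ} {y : Fin m → ℝ} {β : ℝ}
    {z : EuclideanSpace ℝ (Fin n)} : 0 ≤ level β A y z := by
  unfold level
  positivity

lemma grad_mask_of_mem (a : Fin m × Fin n × Fin n → ℝ) {z : EuclideanSpace ℝ (Fin n)}
    (hx : SupportedOn S x) (hz : SupportedOn S z) {j : Fin n} (hj : j ∈ S) :
    grad (arr (mask S a)) (obs (mask S a) x) z j = grad (arr a) (obs a x) z j := by
  rw [grad_apply, grad_apply, gram_mask]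
  · exact (supportedOn_tensor hz hz).sub (supportedOn_tensor hx hx)
  · exact supportedOn_symTensor (supportedOn_single hj) hz

lemma grad_mask_of_notMem (a : Fin m × Fin n × Fin n → ℝ) (x z : EuclideanSpace ℝ (Fin n))
    {j : Fin n} (hj : j ∉ S) : grad (arr (mask S a)) (obs (mask S a) x) z j = 0 := by
  rw [grad_apply, gram]
  simp only [inner_row_mask_eq_zero a _ (symTensor_single_eq_zero hj z), mul_zero,
    Finset.sum_const_zero]

/-- Gradient step and threshold carry the same factor `μ / φ²`, so comparing gradient and level is
enough. -/
lemma update_apply_eq_zero {𝒯 : ℝ → ℝ → ℝ} (h𝒯 : IsThresholding 𝒯) {β μ : ℝ} (hμ : 0 ≤ μ)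
    {A : Fin m → Matrix (Fin n) (Fin n) ℝ} {y : Fin m → ℝ} {z : EuclideanSpace ℝ (Fin n)}
    {j : Fin n} (hz : z j = 0) (hg : |grad A y z j| ≤ level β A y z) :
    update 𝒯 β μ A y z j = 0 := by
  have hν : 0 ≤ μ / phi y ^ 2 := by positivity
  refine (h𝒯 _ (mul_nonneg hν level_nonneg) _).1 ?_
  rw [hz, zero_sub, abs_neg, abs_mul, abs_of_nonneg hν]
  exact mul_le_mul_of_nonneg_left hg hν

lemma supportedOn_update_mask {𝒯 : ℝ → ℝ → ℝ} (h𝒯 : IsThresholding 𝒯) {β μ : ℝ} (hμ : 0 ≤ μ)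
    (a : Fin m × Fin n × Fin n → ℝ) (x : EuclideanSpace ℝ (Fin n)) {z : EuclideanSpace ℝ (Fin n)}
    (hz : SupportedOn S z) :
    SupportedOn S (update 𝒯 β μ (arr (mask S a)) (obs (mask S a) x) z) := by
  intro j hj
  refine update_apply_eq_zero h𝒯 hμ (hz j hj) ?_
  rw [grad_mask_of_notMem a x z hj, abs_zero]
  exact level_nonneg

/-- Inside `S` the update uses only unmasked entries; outside `S` both updates are thresholded to
zero, the masked one because its gradient vanishes and the true one by `hoff`. -/
lemma update_mask {𝒯 : ℝ → ℝ → ℝ} (h𝒯 : IsThresholding 𝒯) {β μ : ℝ} (hμ : 0 ≤ μ)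
    (a : Fin m × Fin n × Fin n → ℝ) (hx : SupportedOn S x) {z : EuclideanSpace ℝ (Fin n)}
    (hz : SupportedOn S z)
    (hoff : ∀ j, j ∉ S → |grad (arr a) (obs a x) z j| ≤ level β (arr a) (obs a x) z) :
    update 𝒯 β μ (arr (mask S a)) (obs (mask S a) x) z = update 𝒯 β μ (arr a) (obs a x) z := by
  ext j
  by_cases hj : j ∈ S
  · simp only [update]
    rw [level_mask β a hx hz, grad_mask_of_mem a hx hz hj, obs_mask a hx]
  · rw [supportedOn_update_mask h𝒯 hμ a x hz j hj,
      update_apply_eq_zero h𝒯 hμ (hz j hj) (hoff j hj)]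

lemma suppEst_mask_subset {α : ℝ} (hα : 0 ≤ α) (a : Fin m × Fin n × Fin n → ℝ)
    (x : EuclideanSpace ℝ (Fin n)) : suppEst α (arr (mask S a)) (obs (mask S a) x) ⊆ S := by
  intro l hl
  by_contra hlS
  simp only [suppEst, Finset.mem_filter, Finset.mem_univ, true_and] at hl
  have h0 : diagStat (arr (mask S a)) (obs (mask S a) x) l = 0 := by
    rw [diagStat_eq, gram]
    simp only [inner_row_mask_eq_zero a _ (tensor_single_eq_zero hlS), mul_zero,
      Finset.sum_const_zero]
  rw [h0] at hl
  have : 0 ≤ α * phi (obs (mask S a) x) ^ 2 * √(Real.log n / m) := by positivity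
  linarith

lemma suppEst_mask {α : ℝ} (hα : 0 ≤ α) (a : Fin m × Fin n × Fin n → ℝ) (hx : SupportedOn S x)
    (hoff : ∀ l, l ∉ S →
      diagStat (arr a) (obs a x) l ≤ α * phi (obs a x) ^ 2 * √(Real.log n / m)) :
    suppEst α (arr (mask S a)) (obs (mask S a) x) = suppEst α (arr a) (obs a x) := by
  ext l
  by_cases hl : l ∈ S
  · have e : diagStat (arr (mask S a)) (obs (mask S a) x) l = diagStat (arr a) (obs a x) l := by
      rw [diagStat_eq, diagStat_eq, gram_mask a (supportedOn_tensor hx hx)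
        (supportedOn_tensor (supportedOn_single hl) (supportedOn_single hl))]
    simp only [suppEst, Finset.mem_filter, Finset.mem_univ, true_and, e]
    rw [obs_mask a hx]
  · refine iff_of_false (fun h => hl (suppEst_mask_subset hα a x h)) ?_
    simp only [suppEst, Finset.mem_filter, Finset.mem_univ, true_and, not_lt]
    exact hoff l hl

lemma restrict_dataMatrix_mask (a : Fin m × Fin n × Fin n → ℝ) (y : Fin m → ℝ)
    {S₀ : Finset (Fin n)} (hS₀ : S₀ ⊆ S) :
    restrict S₀ (symPart (dataMatrix (arr (mask S a)) y)) =
      restrict S₀ (symPart (dataMatrix (arr a) y)) := by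
  ext j l
  simp only [restrict, Matrix.of_apply]
  by_cases h : j ∈ S₀ ∧ l ∈ S₀
  · have h1 := hS₀ h.1
    have h2 := hS₀ h.2
    simp [h, symPart, dataMatrix, Matrix.sum_apply, mask, h1, h2]
  · simp only [if_neg h]

lemma supportedOn_powerLimit {M : Matrix (Fin n) (Fin n) ℝ} {S₀ : Finset (Fin n)} (hS₀ : S₀ ⊆ S)
    (hx : SupportedOn S x) : SupportedOn S (powerLimit (restrict S₀ M) x) := by
  have h : ∀ k, SupportedOn S (powerIter (restrict S₀ M) x k) := by
    intro k
    cases k with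
    | zero => exact hx
    | succ k =>
      intro j hj
      have : j ∉ S₀ := fun h => hj (hS₀ h)
      simp [powerIter, Matrix.mulVec, dotProduct, restrict, this]
  intro j hj
  have hj' := fun k => h k j hj
  simp [powerLimit, hj']

lemma supportedOn_candidate_mask {𝒯 : ℝ → ℝ → ℝ} (h𝒯 : IsThresholding 𝒯) {α β μ : ℝ}
    (hα : 0 ≤ α) (hμ : 0 ≤ μ) (σ : ℝ) (hx : SupportedOn S x) (a : Fin m × Fin n × Fin n → ℝ)
    (t : ℕ) : SupportedOn S (candidate 𝒯 α β μ σ x (mask S a) t) := by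
  induction t with
  | zero => exact (supportedOn_powerLimit (suppEst_mask_subset hα a x) hx).smul _
  | succ t ih => exact supportedOn_update_mask h𝒯 hμ a x ih

/-- The regularity conditions on the data under which the algorithm converges. -/
structure GoodData (S : Finset (Fin n)) (𝒯 : ℝ → ℝ → ℝ) (α β μ : ℝ) (T : ℕ)
    (x : EuclideanSpace ℝ (Fin n)) (a : Fin m × Fin n × Fin n → ℝ) : Prop where
  rip : IsRIP a (S ×ˢ S) (1 / 20000)
  diag_mem : ∀ l ∈ S, |diagStat (arr a) (obs a x) l - x l ^ 2| ≤ 12 * √(Real.log n / m)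
  diag_notMem : ∀ l, l ∉ S →
    diagStat (arr a) (obs a x) l ≤ α * phi (obs a x) ^ 2 * √(Real.log n / m)
  grad_notMem : ∀ j, j ∉ S → ∀ t < T, ∀ σ : ℝ, σ = 1 ∨ σ = -1 →
    |grad (arr a) (obs a x) (candidate 𝒯 α β μ σ x (mask S a) t) j| ≤
      level β (arr a) (obs a x) (candidate 𝒯 α β μ σ x (mask S a) t)

variable {𝒯 : ℝ → ℝ → ℝ} {α β μ : ℝ} {T : ℕ} {a : Fin m × Fin n × Fin n → ℝ}

/-- A missed index has `x_l² ≤ (2α + 12) √(log n / m)`, because `φ² ≤ 2`. Summing over at most `|S|`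
of them is the second place where `m ≳ k² log n` is needed. -/
lemma norm_sub_coordProj_suppEst_le (h : GoodData S 𝒯 α β μ T x a) (hα : 0 ≤ α) (hx : ‖x‖ = 1)
    (hxS : SupportedOn S x) {ε : ℝ} (hε : 0 ≤ ε)
    (hsmall : S.card * ((2 * α + 12) * √(Real.log n / m)) ≤ ε ^ 2) :
    ‖x - coordProj (suppEst α (arr a) (obs a x)) x‖ ≤ ε := by
  obtain ⟨-, -, hφ⟩ := phi_bounds h.rip (by norm_num) hx hxS
  set q := √(Real.log n / m)
  have hq : 0 ≤ q := Real.sqrt_nonneg _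
  refine le_of_sq_le_sq ?_ hε
  refine le_trans ?_ hsmall
  rw [EuclideanSpace.norm_sq_eq, ← Finset.sum_subset (Finset.subset_univ S)]
  · rw [← nsmul_eq_mul]
    refine Finset.sum_le_card_nsmul _ _ _ fun l hl => ?_
    rw [PiLp.sub_apply, Real.norm_eq_abs, sq_abs]
    by_cases hl0 : l ∈ suppEst α (arr a) (obs a x)
    · simp only [coordProj, hl0, if_true, sub_self]
      rw [zero_pow two_ne_zero]
      positivity
    · simp only [coordProj, hl0, if_false, sub_zero]
      simp only [suppEst, Finset.mem_filter, Finset.mem_univ, true_and, not_lt] at hl0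
      have h1 := (abs_le.1 (h.diag_mem l hl)).1
      have h2 : α * phi (obs a x) ^ 2 * q ≤ α * 2 * q := by gcongr
      change _ ≤ α * phi (obs a x) ^ 2 * q at hl0
      linarith
  · intro l _ hl
    simp [coordProj, hxS l hl]

lemma spectralInit_eq_candidate (h : GoodData S 𝒯 α β μ T x a) (hα : 0 ≤ α) (hx : ‖x‖ = 1)
    (hxS : SupportedOn S x)
    (hsmall : S.card * ((2 * α + 12) * √(Real.log n / m)) ≤ (1 / 50000) ^ 2)
    {z : EuclideanSpace ℝ (Fin n)} (hz : IsSpectralInit α (arr a) (obs a x) z) :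
    (∃ σ : ℝ, (σ = 1 ∨ σ = -1) ∧ z = candidate 𝒯 α β μ σ x (mask S a) 0) ∧
      ∃ σ : ℝ, (σ = 1 ∨ σ = -1) ∧ ‖z - σ • x‖ ≤ 1 / 20 := by
  obtain ⟨v, hv, rfl⟩ := hz
  obtain ⟨hφ, -, -⟩ := phi_bounds h.rip (by norm_num) hx hxS
  have hsupp := suppEst_mask hα a hxS h.diag_notMem
  set M := restrict (suppEst α (arr a) (obs a x)) (symPart (dataMatrix (arr a) (obs a x))) with hM
  have hMsymm : Mᵀ = M := restrict_isSymm _ (symPart_isSymm _)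
  have hsub : suppEst α (arr a) (obs a x) ⊆ S := hsupp ▸ suppEst_mask_subset hα a x
  -- `1/20000 + 2/50000 ≤ 1/10000`.
  have hnear : NearRankOne M x (1 / 10000) := by
    have h1 := nearRankOne_restrict h.rip (by norm_num) hx hxS hsub
      (norm_sub_coordProj_suppEst_le h hα hx hxS (by norm_num) hsmall)
    intro w w'
    refine (h1 w w').trans ?_
    gcongr
    norm_num
  have hover := leading_eigenvector_overlap hMsymm hx hnear hv
  constructor
  · have hpl := powerLimit_eq hMsymm hx hnear (by norm_num) hv
    have hs : inner ℝ v x ≠ 0 := by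
      intro h0
      rw [h0] at hover
      norm_num at hover
    have hcand : ∀ σ : ℝ, candidate 𝒯 α β μ σ x (mask S a) 0 =
        (phi (obs a x) * σ) • powerLimit M x := by
      intro σ
      simp only [candidate, initCandidate]
      rw [hsupp, obs_mask a hxS, restrict_dataMatrix_mask a _ hsub]
    have key : ∀ σ : ℝ, σ * (|inner ℝ v x|⁻¹ * inner ℝ v x) = 1 →
        phi (obs a x) • v = candidate 𝒯 α β μ σ x (mask S a) 0 := by
      intro σ hσ
      rw [hcand, hpl, smul_smul, mul_assoc, hσ, mul_one]
    rcases lt_or_gt_of_ne hs with hneg | hpos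
    · refine ⟨-1, Or.inr rfl, key _ ?_⟩
      rw [abs_of_neg hneg]
      field_simp
    · refine ⟨1, Or.inl rfl, key _ ?_⟩
      rw [abs_of_pos hpos]
      field_simp
  · obtain ⟨σ, hσ, hσx⟩ := norm_sign_smul_sub_le hx hv.1 hover le_rfl
    refine ⟨σ, hσ, ?_⟩
    have e : phi (obs a x) • v - σ • x = (phi (obs a x) - 1) • v + (v - σ • x) := by module
    rw [e]
    refine (norm_add_le _ _).trans ?_
    rw [norm_smul, hv.1, mul_one, Real.norm_eq_abs]
    linarith

/-- The observations are even in the signal, so a run near `-x` is handled by the contraction with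
signal `-x`. -/
lemma obs_sign_smul (a : Fin m × Fin n × Fin n → ℝ) (x : EuclideanSpace ℝ (Fin n)) {σ : ℝ}
    (hσ : σ = 1 ∨ σ = -1) : obs a (σ • x) = obs a x := by
  funext i
  rcases hσ with rfl | rfl
  · rw [one_smul]
  · simp [obs, quad, Matrix.mulVec_neg]

/-- On good data every run of the algorithm converges linearly. -/
lemma GoodData.dist_le (h : GoodData S 𝒯 α β μ T x a) (h𝒯 : IsThresholding 𝒯) (hα : 0 ≤ α)
    (hμ : 0 < μ) (hμ1 : μ ≤ 1 / 4) (hx : ‖x‖ = 1) (hxS : SupportedOn S x)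
    (hsmall : S.card * ((2 * α + 12) * √(Real.log n / m)) ≤ (1 / 50000) ^ 2)
    (hSβ : S.card * (β / m) ≤ 1 / 10000) {z : ℕ → EuclideanSpace ℝ (Fin n)}
    (hz : IsTWFSequence 𝒯 α β μ T (arr a) (obs a x) z) :
    ∀ t ≤ T, min ‖z t - x‖ ‖z t + x‖ ≤ (1 - μ / 16) ^ t := by
  obtain ⟨hz0, hstep⟩ := hz
  obtain ⟨⟨σ, hσ, hzσ⟩, ⟨ρ, hρ, hzρ⟩⟩ := spectralInit_eq_candidate h hα hx hxS hsmall hz0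
  have hμ2 : 0 ≤ 1 - μ / 16 := by linarith
  have hρx : ‖ρ • x‖ = 1 := by
    rcases hρ with rfl | rfl <;> simp [hx]
  have hrip : IsRIP a (S ×ˢ S) (1 / 100) := fun M N hM hN =>
    (h.rip M N hM hN).trans (by gcongr; norm_num)
  -- The two claims are carried together: coincidence supplies the support and the off-support
  -- gradient bound, and the distance bound keeps the iterate in the contraction region. The sign
  -- `σ` identifies the masked run and `ρ` the nearby signal; no relation between them is required.
  have main : ∀ t ≤ T, z t = candidate 𝒯 α β μ σ x (mask S a) t ∧
      ‖z t - ρ • x‖ ≤ (1 - μ / 16) ^ t * (1 / 20) := by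
    intro t
    induction t with
    | zero => exact fun _ => ⟨hzσ, by simpa using hzρ⟩
    | succ t ih =>
      intro ht
      obtain ⟨h1, h2⟩ := ih (by omega)
      have hsupp : SupportedOn S (z t) :=
        h1 ▸ supportedOn_candidate_mask h𝒯 hα hμ.le σ hxS a t
      have hup := update_mask h𝒯 hμ.le a hxS hsupp (β := β) fun j hj =>
        h1 ▸ h.grad_notMem j hj t (by omega) σ hσ
      have hpow : (1 - μ / 16) ^ t ≤ 1 := pow_le_one₀ hμ2 (by linarith)
      refine ⟨?_, ?_⟩
      · rw [hstep t (by omega), ← hup]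
        simp only [candidate, h1]
      · have hc := norm_update_sub_le h𝒯 (z := z t) (β := β) hrip hρx (hxS.smul ρ) hsupp
          (by linarith) hμ hμ1 hSβ (by
            rw [obs_sign_smul a x hρ, ← hup]
            exact supportedOn_update_mask h𝒯 hμ.le a x hsupp)
        rw [obs_sign_smul a x hρ, ← hstep t (by omega)] at hc
        refine hc.trans ?_
        rw [pow_succ]
        nlinarith
  intro t ht
  have h2 := (main t ht).2
  have hpow : 0 ≤ (1 - μ / 16) ^ t := pow_nonneg hμ2 t
  have h3 : ‖z t - ρ • x‖ ≤ (1 - μ / 16) ^ t := by linarith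
  rcases hρ with rfl | rfl
  · rw [one_smul] at h3
    exact (min_le_left _ _).trans h3
  · rw [neg_smul, one_smul, sub_neg_eq_add] at h3
    exact (min_le_right _ _).trans h3

end Tracking

/-! ### Probability of the good event -/

section Probability

variable {n m : ℕ} {S : Finset (Fin n)} {x : EuclideanSpace ℝ (Fin n)}

lemma exp_neg_nine_mul_log (hn : 2 ≤ n) : Real.exp (-(9 * Real.log n)) = ((n : ℝ) ^ 9)⁻¹ := by
  have : (0 : ℝ) < n := by positivity
  rw [Real.exp_neg, mul_comm, Real.exp_mul, Real.exp_log this]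
  norm_cast

lemma diag_mem_tail (hn : 2 ≤ n) (hm : 0 < m) (hx : ‖x‖ = 1)
    (hq : √(Real.log n / m) ≤ 1 / 6) (l : Fin n) :
    (gaussianPi (Fin m × Fin n × Fin n)).real
      {a | ¬ |diagStat (arr a) (obs a x) l - x l ^ 2| ≤ 12 * √(Real.log n / m)} ≤
      4 * ((n : ℝ) ^ 9)⁻¹ := by
  have hm0 : (0 : ℝ) < m := Nat.cast_pos.2 hm
  have hlog : 0 ≤ Real.log n := Real.log_natCast_nonneg n
  have h := gram_tail hm (tensor x x)
    (tensor (EuclideanSpace.single l 1) (EuclideanSpace.single l 1))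
    (ε := 12 * √(Real.log n / m)) (by positivity) (by linarith)
  have e : (m : ℝ) * (12 * √(Real.log n / m)) ^ 2 / 16 = 9 * Real.log n := by
    rw [mul_pow, Real.sq_sqrt (by positivity)]
    field_simp
    ring
  rw [e, exp_neg_nine_mul_log hn] at h
  refine (measureReal_mono fun a ha => ?_).trans h
  simp only [Set.mem_ofPred_eq, not_le] at ha ⊢
  rw [← diagStat_eq, inner_tensor, norm_tensor, norm_tensor, hx, EuclideanSpace.inner_single_right]
  simpa only [PiLp.norm_single, norm_one, mul_one, conj_trivial, one_mul, ← pow_two, one_pow]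
    using ha

/-- Given the `S × S` block, the statistic is centred Gaussian with standard deviation `φ² / √m`.
The threshold is `α √(log n)` deviations, and `α² / 2 ≥ 9`. -/
lemma diag_notMem_tail (hn : 2 ≤ n) {α : ℝ} (hα : 5 ≤ α)
    (hxS : SupportedOn S x) {l : Fin n} (hl : l ∉ S) :
    (gaussianPi (Fin m × Fin n × Fin n)).real
      {a | ¬ diagStat (arr a) (obs a x) l ≤ α * phi (obs a x) ^ 2 * √(Real.log n / m)} ≤
      2 * ((n : ℝ) ^ 9)⁻¹ := by
  have hlog : 0 ≤ Real.log n := Real.log_natCast_nonneg n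
  have h := offSupport_tail (m := m) S (fun a => obs a x)
    (fun _ => tensor (EuclideanSpace.single l 1) (EuclideanSpace.single l 1))
    (fun i => measurable_obs x i) (fun p => measurable_const)
    (fun a => tensor_single_eq_zero hl) (s := α * √(Real.log n)) (by positivity)
  have hexp : Real.exp (-(α * √(Real.log n)) ^ 2 / 2) ≤ ((n : ℝ) ^ 9)⁻¹ := by
    rw [← exp_neg_nine_mul_log hn, mul_pow, Real.sq_sqrt hlog]
    refine Real.exp_le_exp.2 ?_
    nlinarith [mul_nonneg hlog (by nlinarith : 0 ≤ α ^ 2 - 18)]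
  refine (measureReal_mono ?_).trans (h.trans (by linarith))
  intro a ha
  simp only [Set.mem_ofPred_eq, not_le] at ha ⊢
  rw [obs_mask a hxS]
  have e1 : (1 / (m : ℝ)) * ∑ i, obs a x i * inner ℝ (row a i)
      (tensor (EuclideanSpace.single l 1) (EuclideanSpace.single l 1)) =
      diagStat (arr a) (obs a x) l := by
    rw [diagStat_eq, gram]
    simp only [obs, quad_arr]
  have e2 : 1 / (m : ℝ) ^ 2 * ∑ i, obs a x i ^ 2 = 1 / m * (phi (obs a x) ^ 2) ^ 2 := by
    rw [← pow_mul, phi_pow_four, gram]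
    simp only [obs, quad_arr, ← pow_two]
    ring
  rw [e1, e2, norm_tensor, Real.sqrt_mul (by positivity), Real.sqrt_sq (by positivity)]
  refine lt_of_le_of_lt ?_ (ha.trans_le (le_abs_self _))
  rw [PiLp.norm_single, norm_one, div_eq_mul_one_div (Real.log n), Real.sqrt_mul hlog]
  exact le_of_eq (by ring)

/-- The level is at least `√β` conditional standard deviations, since `‖symTensor e_j z‖ ≤ ‖z‖`; and
`β / 2 ≥ 9 log n`. -/
lemma grad_notMem_tail (hn : 2 ≤ n) {𝒯 : ℝ → ℝ → ℝ} (h𝒯 : IsThresholding 𝒯)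
    (h𝒯m : Measurable (Function.uncurry 𝒯)) {α β μ : ℝ} (hα : 0 ≤ α)
    (hβ : 18 * Real.log n ≤ β) (hμ : 0 ≤ μ) (σ : ℝ) (t : ℕ) (hxS : SupportedOn S x) {j : Fin n}
    (hj : j ∉ S) :
    (gaussianPi (Fin m × Fin n × Fin n)).real
      {a | ¬ |grad (arr a) (obs a x) (candidate 𝒯 α β μ σ x (mask S a) t) j| ≤
        level β (arr a) (obs a x) (candidate 𝒯 α β μ σ x (mask S a) t)} ≤
      2 * ((n : ℝ) ^ 9)⁻¹ := by
  have hlog : 0 ≤ Real.log n := Real.log_natCast_nonneg n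
  have hβ0 : 0 ≤ β := by linarith
  have hcm := fun l => measurable_candidate (m := m) h𝒯m α β μ σ x t l
  have h := offSupport_tail (m := m) S
    (fun a i => quad (arr a i) (candidate 𝒯 α β μ σ x a t) - obs a x i)
    (fun a => symTensor (EuclideanSpace.single j 1) (candidate 𝒯 α β μ σ x a t))
    (fun i => (measurable_quad_arr hcm i).sub (measurable_obs x i))
    (fun p => by
      simp only [symTensor, PiLp.smul_apply, PiLp.add_apply, tensor_apply, smul_eq_mul]
      exact ((((hcm p.2).const_mul _).add ((hcm p.1).mul_const _)).const_mul _))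
    (fun a => symTensor_single_eq_zero hj _) (s := √β) (by positivity)
  have hexp : Real.exp (-√β ^ 2 / 2) ≤ ((n : ℝ) ^ 9)⁻¹ := by
    rw [← exp_neg_nine_mul_log hn, Real.sq_sqrt hβ0]
    exact Real.exp_le_exp.2 (by linarith)
  refine (measureReal_mono ?_).trans (h.trans (by linarith))
  intro a ha
  simp only [Set.mem_ofPred_eq, not_le] at ha ⊢
  have hz := supportedOn_candidate_mask h𝒯 hα hμ σ hxS a t (β := β)
  set z := candidate 𝒯 α β μ σ x (mask S a) t
  simp only [obs_mask a hxS, quad_mask a _ hz]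
  have e1 : (1 / (m : ℝ)) * ∑ i, (quad (arr a i) z - obs a x i) * inner ℝ (row a i)
      (symTensor (EuclideanSpace.single j 1) z) = grad (arr a) (obs a x) z j := by
    rw [grad_apply, gram]
    simp only [obs, quad_arr, inner_sub_right]
  rw [e1]
  refine lt_of_le_of_lt ?_ ha
  have hN : ‖symTensor (EuclideanSpace.single j 1) z‖ ≤ ‖z‖ := by
    have := norm_symTensor_le (EuclideanSpace.single j 1) z
    rwa [PiLp.norm_single, norm_one, one_mul] at this
  rw [level, ← mul_assoc, ← Real.sqrt_mul hβ0, ← mul_assoc, mul_one_div]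
  gcongr

/-- Take `L = 4|S|` and `δ = 1/80000`. The grid entropy is at most `10 |S|² log n ≤ m / (2.5 ·
10¹¹)`, less than half of the exponent `m δ² / 16`; the other half survives as the final rate. -/
lemma rip_tail (hn : 2 ≤ n) (hS : 0 < S.card)
    (hm : 2500000000000 * ((S.card : ℝ) ^ 2 * Real.log n) ≤ m) (hm0 : 0 < m) :
    (gaussianPi (Fin m × Fin n × Fin n)).real {a | ¬ IsRIP a (S ×ˢ S) (1 / 20000)} ≤
      4 * Real.exp (-(1 / 204800000000) * m) := by
  have hL : 16 * (S ×ˢ S).card ≤ (4 * S.card) ^ 2 := by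
    rw [Finset.card_product]
    exact le_of_eq (by ring)
  have h := isRIP_probability hm0 (S ×ˢ S) (by positivity) hL
    (δ := 1 / 80000) (by norm_num) (by norm_num)
  rw [Finset.card_product] at h
  norm_num at h
  refine le_trans (le_of_eq (by norm_num)) (h.trans ?_)
  have hn0 : (0 : ℝ) < n := by positivity
  have hn2 : (2 : ℝ) ≤ n := by exact_mod_cast hn
  have hsn : (S.card : ℝ) ≤ n := by exact_mod_cast card_finset_fin_le S
  have hbase : (2 * (4 * (S.card : ℝ)) + 1) ≤ (n : ℝ) ^ 5 := by
    have : (2 : ℝ) ^ 4 ≤ (n : ℝ) ^ 4 := by gcongr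
    have h5 : (n : ℝ) ^ 5 = n ^ 4 * n := by ring
    nlinarith
  have hpow : (2 * (4 * (S.card : ℝ)) + 1) ^ (2 * (S.card * S.card)) ≤
      Real.exp (10 * ((S.card : ℝ) ^ 2 * Real.log n)) := by
    calc _ ≤ ((n : ℝ) ^ 5) ^ (2 * (S.card * S.card)) := by gcongr
      _ = Real.exp (10 * ((S.card : ℝ) ^ 2 * Real.log n)) := by
        rw [← pow_mul, ← Real.exp_log (pow_pos hn0 _), Real.log_pow]
        congr 1
        push_cast
        ring
  rw [mul_assoc]
  refine mul_le_mul_of_nonneg_left ?_ (by norm_num)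
  refine (mul_le_mul_of_nonneg_right hpow (Real.exp_nonneg _)).trans ?_
  rw [← Real.exp_add]
  refine Real.exp_le_exp.2 ?_
  linarith

/-- Union bound: each failure has probability of order `n⁻⁹`, and there are at most `n` indices, `T`
times and two signs. The total `4 + 2 + 4T` is at most `10T` as `T ≥ 1`. -/
lemma goodData_probability (hn : 2 ≤ n) (hS : 0 < S.card)
    (hm : 2500000000000 * ((S.card : ℝ) ^ 2 * Real.log n) ≤ m) (hm0 : 0 < m)
    (hq : √(Real.log n / m) ≤ 1 / 6) {𝒯 : ℝ → ℝ → ℝ} (h𝒯 : IsThresholding 𝒯)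
    (h𝒯m : Measurable (Function.uncurry 𝒯)) {α β μ : ℝ} (hα : 5 ≤ α)
    (hβ : 18 * Real.log n ≤ β) (hμ : 0 ≤ μ) {T : ℕ} (hT : 1 ≤ T) (hx : ‖x‖ = 1)
    (hxS : SupportedOn S x) :
    (gaussianPi (Fin m × Fin n × Fin n)).real {a | ¬ GoodData S 𝒯 α β μ T x a} ≤
      10 * T * ((n : ℝ) ^ 8)⁻¹ + 4 * Real.exp (-(1 / 204800000000) * m) := by
  let Q := gaussianPi (Fin m × Fin n × Fin n)
  let E₁ : Set (Fin m × Fin n × Fin n → ℝ) := {a | ¬ IsRIP a (S ×ˢ S) (1 / 20000)}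
  let E₂ : Set (Fin m × Fin n × Fin n → ℝ) := ⋃ l : Fin n,
    {a | ¬ |diagStat (arr a) (obs a x) l - x l ^ 2| ≤ 12 * √(Real.log n / m)}
  let E₃ : Set (Fin m × Fin n × Fin n → ℝ) := ⋃ l : {l : Fin n // l ∉ S},
    {a | ¬ diagStat (arr a) (obs a x) l ≤ α * phi (obs a x) ^ 2 * √(Real.log n / m)}
  let E₄ : Set (Fin m × Fin n × Fin n → ℝ) := ⋃ q : {l : Fin n // l ∉ S} × Fin T × Bool,
    {a | ¬ |grad (arr a) (obs a x)
        (candidate 𝒯 α β μ (if q.2.2 then 1 else -1) x (mask S a) q.2.1) q.1| ≤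
      level β (arr a) (obs a x)
        (candidate 𝒯 α β μ (if q.2.2 then 1 else -1) x (mask S a) q.2.1)}
  have hsub : {a | ¬ GoodData S 𝒯 α β μ T x a} ⊆ (E₁ ∪ E₂) ∪ (E₃ ∪ E₄) := by
    intro a ha
    by_contra hcon
    simp only [Set.mem_union, not_or] at hcon
    obtain ⟨⟨h1, h2⟩, h3, h4⟩ := hcon
    simp only [E₁, E₂, E₃, E₄, Set.mem_iUnion, Set.mem_ofPred_eq, not_exists, not_not]
      at h1 h2 h3 h4
    refine ha ⟨h1, fun l _ => h2 l, fun l hl => h3 ⟨l, hl⟩, fun j hj t ht σ hσ => ?_⟩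
    rcases hσ with rfl | rfl
    · exact h4 (⟨j, hj⟩, ⟨t, ht⟩, true)
    · exact h4 (⟨j, hj⟩, ⟨t, ht⟩, false)
  have hn0 : (0 : ℝ) < n := by positivity
  have hT1 : (1 : ℝ) ≤ T := by exact_mod_cast hT
  have hcard : (Fintype.card {l : Fin n // l ∉ S} : ℝ) ≤ n := by
    have := Fintype.card_subtype_le fun l : Fin n => l ∉ S
    rw [Fintype.card_fin] at this
    exact_mod_cast this
  have hp : (n : ℝ) * ((n : ℝ) ^ 9)⁻¹ = ((n : ℝ) ^ 8)⁻¹ := by field_simp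
  have b1 : Q.real E₁ ≤ 4 * Real.exp (-(1 / 204800000000) * m) := rip_tail hn hS hm hm0
  have b2 : Q.real E₂ ≤ 4 * ((n : ℝ) ^ 8)⁻¹ := by
    refine (measureReal_iUnion_fintype_le _).trans
      ((Finset.sum_le_sum fun l _ => diag_mem_tail hn hm0 hx hq l).trans (le_of_eq ?_))
    rw [Finset.sum_const, Finset.card_univ, Fintype.card_fin, nsmul_eq_mul, ← hp]
    ring
  have b3 : Q.real E₃ ≤ 2 * ((n : ℝ) ^ 8)⁻¹ := by
    refine (measureReal_iUnion_fintype_le _).trans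
      ((Finset.sum_le_sum fun l _ => diag_notMem_tail hn hα hxS l.2).trans ?_)
    rw [Finset.sum_const, Finset.card_univ, nsmul_eq_mul, ← hp]
    calc _ ≤ (n : ℝ) * (2 * ((n : ℝ) ^ 9)⁻¹) := by gcongr
      _ = _ := by ring
  have b4 : Q.real E₄ ≤ 4 * T * ((n : ℝ) ^ 8)⁻¹ := by
    refine (measureReal_iUnion_fintype_le _).trans
      ((Finset.sum_le_sum fun q _ => grad_notMem_tail hn h𝒯 h𝒯m (by linarith) hβ hμ
        (if q.2.2 then 1 else -1) q.2.1 hxS q.1.2).trans ?_)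
    rw [Finset.sum_const, Finset.card_univ, nsmul_eq_mul, ← hp, Fintype.card_prod,
      Fintype.card_prod, Fintype.card_bool, Fintype.card_fin]
    push_cast
    calc _ ≤ (n : ℝ) * (T * 2) * (2 * ((n : ℝ) ^ 9)⁻¹) := by gcongr
      _ = _ := by ring
  calc Q.real {a | ¬ GoodData S 𝒯 α β μ T x a} ≤ Q.real ((E₁ ∪ E₂) ∪ (E₃ ∪ E₄)) :=
        measureReal_mono hsub
    _ ≤ (Q.real E₁ + Q.real E₂) + (Q.real E₃ + Q.real E₄) :=
        (measureReal_union_le _ _).trans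
          (add_le_add (measureReal_union_le _ _) (measureReal_union_le _ _))
    _ ≤ _ := by
        have h0 : 0 < ((n : ℝ) ^ 8)⁻¹ := by positivity
        nlinarith

/-- A property of the Gaussian array holds on a measurable event of the original space. -/
lemma exists_measurableSet_of_gaussianPi {Ω ι : Type*} [Fintype ι] [MeasurableSpace Ω]
    {P : Measure Ω} [IsProbabilityMeasure P] {f : Ω → ι → ℝ} (hf : HasLaw f (gaussianPi ι) P)
    {p : (ι → ℝ) → Prop} {r : ℝ} (hr : (gaussianPi ι).real {a | ¬ p a} ≤ r) :
    ∃ G : Set Ω, MeasurableSet G ∧ 1 - r ≤ P.real G ∧ ∀ ω ∈ G, p (f ω) := by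
  set B := f ⁻¹' {a | ¬ p a} with hB
  -- The property need not be measurable, so its bad event is replaced by a measurable hull of the
  -- same outer measure.
  refine ⟨(toMeasurable P B)ᶜ, (measurableSet_toMeasurable P B).compl, ?_, fun ω hω => ?_⟩
  · rw [probReal_compl_eq_one_sub (measurableSet_toMeasurable P B)]
    have h1 : P (toMeasurable P B) ≤ gaussianPi ι {a | ¬ p a} := by
      rw [measure_toMeasurable, ← measure_toMeasurable {a | ¬ p a}, ← hf.map_eq,
        Measure.map_apply_of_aemeasurable hf.aemeasurable (measurableSet_toMeasurable _ _)]
      exact measure_mono (Set.preimage_mono (subset_toMeasurable _ _))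
    have h2 : P.real (toMeasurable P B) ≤ (gaussianPi ι).real {a | ¬ p a} :=
      ENNReal.toReal_mono (measure_ne_top _ _) h1
    linarith
  · by_contra hcon
    exact hω (subset_toMeasurable P B hcon)

lemma IsStdGaussianFamily.hasLaw {Ω : Type*} [MeasurableSpace Ω] {P : Measure Ω}
    {A : Fin m → Ω → Matrix (Fin n) (Fin n) ℝ} (hA : IsStdGaussianFamily P A) :
    HasLaw (fun ω (p : Fin m × Fin n × Fin n) => A p.1 ω p.2.1 p.2.2)
      (gaussianPi (Fin m × Fin n × Fin n)) P :=
  hA.2.hasLaw_pi fun p => hA.1 p.1 p.2.1 p.2.2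

end Probability

end TWF

end

/-! ### Choice of constants and conclusion -/

theorem theorem1 :
    ∃ α₀ b₀ μ₀ : ℝ, 0 < α₀ ∧ 0 < b₀ ∧ 0 < μ₀ ∧
    ∀ α₁ b₁ : ℝ, ∃ C₀ C₁ C₂ c : ℝ, 0 < C₀ ∧ 0 < C₁ ∧ 0 < C₂ ∧ 0 < c ∧
    ∀ (n m k T : ℕ) (α β μ : ℝ) (𝒯 : ℝ → ℝ → ℝ) (x : EuclideanSpace ℝ (Fin n))
      (Ω : Type*) [MeasurableSpace Ω] (P : Measure Ω) [IsProbabilityMeasure P]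
      (A : Fin m → Ω → Matrix (Fin n) (Fin n) ℝ),
      1 ≤ T →
      α ∈ Set.Icc α₀ α₁ →
      β ∈ Set.Icc (b₀ * Real.log n) (b₁ * Real.log n) →
      μ ∈ Set.Ioc 0 μ₀ →
      TWF.IsThresholding 𝒯 →
      Measurable (Function.uncurry 𝒯) →
      ‖x‖ = 1 →
      TWF.IsSparse k x →
      TWF.IsStdGaussianFamily P A →
      C₀ * (k : ℝ) ^ 2 * Real.log n ≤ m →
      ∃ G : Set Ω, MeasurableSet G ∧
        1 - C₁ * T * ((n : ℝ) ^ 8)⁻¹ - C₂ * Real.exp (-c * m) ≤ P.real G ∧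
        ∀ ω ∈ G, ∀ z : ℕ → EuclideanSpace ℝ (Fin n),
          TWF.IsTWFSequence 𝒯 α β μ T (fun i => A i ω) (fun i => TWF.quad (A i ω) x) z →
          ∀ t ≤ T, min ‖z t - x‖ ‖z t + x‖ ≤ (1 - μ / 16) ^ t := by
  -- `5² / 2` and `18 / 2` are at least `9`, giving tails `n⁻⁹`; `μ ≤ 1/4` with `φ² ≥ 1/2` gives
  -- step size at most `1/2`.
  refine ⟨5, 18, 1 / 4, by norm_num, by norm_num, by norm_num, fun α₁ b₁ => ?_⟩
  set D : ℝ := 2 * |α₁| + 12 with hD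
  have hD12 : 12 ≤ D := by
    have := abs_nonneg α₁
    linarith
  have hDsq : 900000000000000000000 ≤ (2500000000 * D) ^ 2 := by nlinarith
  -- The first term gives `|S| √(log n / m) ≤ 1 / (50000² D)` with `D ≥ 2α + 12`, for the support
  -- estimate, and also covers the sample size for the restricted isometry. The second gives `|S| β
  -- / m ≤ 1/10000`.
  set C₀ : ℝ := (2500000000 * D) ^ 2 + 10000 * |b₁| with hC₀
  have hb₁ := abs_nonneg b₁
  have hC₀pos : 0 < C₀ := by linarith
  refine ⟨C₀, 10, 4, 1 / 204800000000, hC₀pos, by norm_num, by norm_num, by norm_num, ?_⟩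
  intro n m k T α β μ 𝒯 x Ω _ P _ A hT hα hβ hμ h𝒯 h𝒯m hx hk hA hm
  obtain ⟨hα0, hα1⟩ := hα
  obtain ⟨hβ0, hβ1⟩ := hβ
  obtain ⟨hμ0, hμ1⟩ := hμ
  have hT1 : (1 : ℝ) ≤ T := by exact_mod_cast hT
  rcases Nat.lt_or_ge n 2 with hn | hn
  -- No unit vector exists for `n = 0`; for `n = 1` the claimed probability is at most `1 - 10T <
  -- 0`, so the empty event suffices.
  · refine ⟨∅, MeasurableSet.empty, ?_, by simp⟩
    have hexp := Real.exp_nonneg (-(1 / 204800000000) * (m : ℝ))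
    interval_cases n
    · have : x = 0 := Subsingleton.elim _ _
      simp [this] at hx
    · rw [measureReal_empty]
      norm_num at hexp ⊢
      linarith
  set S : Finset (Fin n) := Finset.univ.filter fun j => x j ≠ 0 with hS
  have hxS : TWF.SupportedOn S x := fun j hj => by simpa [hS] using hj
  have hSk : S.card ≤ k := hk
  have hS0 : 0 < S.card := by
    rw [Finset.card_pos, Finset.nonempty_iff_ne_empty]
    intro h
    have : x = 0 := by
      ext j
      exact hxS j (by simp [h])
    simp [this] at hx
  have hlog : 0 < Real.log n := Real.log_pos (by exact_mod_cast hn)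
  have hs1 : (1 : ℝ) ≤ S.card := by exact_mod_cast hS0
  set N : ℝ := (S.card : ℝ) ^ 2 * Real.log n with hN
  have hNpos : 0 < N := by positivity
  have hmN : C₀ * N ≤ m := by
    refine le_trans ?_ hm
    rw [hN, ← mul_assoc]
    gcongr
  have hmpos : (0 : ℝ) < m := lt_of_lt_of_le (by positivity) hmN
  have hm0 : 0 < m := by exact_mod_cast hmpos
  have hsq : S.card * √(Real.log n / m) ≤ 1 / (2500000000 * D) := by
    refine le_of_sq_le_sq ?_ (by positivity)
    rw [mul_pow, Real.sq_sqrt (by positivity), ← mul_div_assoc, div_pow, one_pow,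
      div_le_div_iff₀ hmpos (by positivity), one_mul]
    refine le_trans ?_ hmN
    rw [mul_comm]
    gcongr
    linarith
  have hsmall : S.card * ((2 * α + 12) * √(Real.log n / m)) ≤ (1 / 50000) ^ 2 := by
    have h1 : 2 * α + 12 ≤ D := by linarith [le_abs_self α₁]
    calc _ = (2 * α + 12) * (S.card * √(Real.log n / m)) := by ring
      _ ≤ D * (1 / (2500000000 * D)) := by gcongr
      _ = _ := by field_simp; norm_num
  have hq : √(Real.log n / m) ≤ 1 / 6 := by
    have h1 : √(Real.log n / m) ≤ S.card * √(Real.log n / m) :=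
      le_mul_of_one_le_left (Real.sqrt_nonneg _) hs1
    refine h1.trans (hsq.trans ?_)
    exact one_div_le_one_div_of_le (by norm_num) (by linarith)
  have hSβ : S.card * (β / m) ≤ 1 / 10000 := by
    rw [← mul_div_assoc, div_le_iff₀ hmpos]
    have h1 : β ≤ |b₁| * Real.log n :=
      hβ1.trans (mul_le_mul_of_nonneg_right (le_abs_self _) hlog.le)
    have h2 : S.card * β ≤ |b₁| * N := by
      calc (S.card : ℝ) * β ≤ S.card * (|b₁| * Real.log n) := by gcongr
        _ ≤ (S.card : ℝ) ^ 2 * (|b₁| * Real.log n) := by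
          gcongr
          nlinarith
        _ = _ := by rw [hN]; ring
    have h3 : 10000 * |b₁| * N ≤ C₀ * N := by
      gcongr
      linarith
    linarith
  have hprob := TWF.goodData_probability hn hS0
    (le_trans (mul_le_mul_of_nonneg_right (by linarith) hNpos.le) hmN) hm0 hq h𝒯 h𝒯m hα0 hβ0 hμ0.le
    hT hx hxS
  obtain ⟨G, hGm, hGP, hG⟩ := TWF.exists_measurableSet_of_gaussianPi hA.hasLaw hprob
  refine ⟨G, hGm, by linarith, fun ω hω z hz => ?_⟩
  exact (hG ω hω).dist_le h𝒯 (by linarith) hμ0 hμ1 hx hxS hsmall hSβ hz
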